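/- Theorem (isometric equivalence of self-adjoint operators). Let $V$ be a finite-dimensional real vector space with a scalar product $\langle\cdot,\cdot\rangle$, i.e. a non-degenerate symmetric (not necessarily definite) bilinear form, and let $O(V)$ be the group of linear bijections $R$ of $V$ with $\langle Rx,Ry\rangle=\langle x,y\rangle$ for all $x,y$. Call a linear operator $T$ on $V$ self-adjoint if $\langle Tx,y\rangle=\langle x,Ty\rangle$ for all $x,y\in V$. Consider triples $(\lambda,p,\varepsilon)$ with $\lambda\in\mathbb{C}$, $p\ge 1$ an integer and $\varepsilon\in\{1,-1\}$, such that either $\lambda\in\mathbb{R}$, or $\operatorname{Im}\lambda>0$ and $\varepsilon=1$. A $T$-invariant subspace $W\subseteq V$ is said to be of type $(\lambda,p,\varepsilon)$ in the following cases. (a) $\lambda\in\mathbb{R}$, and $W$ has a basis $v_1,\dots,v_p$ with $\langle v_i,v_j\rangle=\varepsilon$ if $i+j=p+1$ and $\langle v_i,v_j\rangle=0$ otherwise, such that $Tv_1=\lambda v_1$ and $Tv_j=\lambda v_j+v_{j-1}$ for $2\le j\le p$. (b) $\lambda=a+ib$ with $b>0$, $\varepsilon=1$, and $W$ has a basis $u_1,v_1,\dots,u_p,v_p$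 in which all scalar products vanish except $\langle u_i,u_j\rangle=1=-\langle v_i,v_j\rangle$ for $i+j=p+1$, such that, with $u_0=v_0=0$, $Tu_j=a u_j-b v_j+u_{j-1}$ and $Tv_j=b u_j+a v_j+v_{j-1}$ for $1\le j\le p$. A metric-Jordan canonical form of $T$ is an unordered list (multiset) of triples $\{(\lambda_i,p_i,\varepsilon_i)\}_{i=1}^k$ for which $V$ is the direct sum of pairwise orthogonal $T$-invariant subspaces $V_1,\dots,V_k$, with $V_i$ of type $(\lambda_i,p_i,\varepsilon_i)$. Every self-adjoint operator on $V$ has exactly one metric-Jordan canonical form. Two self-adjoint operators $S$ and $T$ on $V$ satisfy $T=RSR^{-1}$ for some $R\in O(V)$ if and only if they have the same metric-Jordan canonical form. -/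

import Mathlib

namespace MetricJordan

/-- The `p × p` upper triangular Jordan block with eigenvalue `l`. -/
def jordanBlock (l : ℝ) (p : ℕ) : Matrix (Fin p) (Fin p) ℝ :=
  Matrix.of fun i j => if i = j then l else if (i : ℕ) + 1 = j then 1 else 0

/-- The `p × p` Gram matrix of a skew-normal sequence of sign `ε`: the entry `(i, j)`, counted
from `1`, is `ε` if `i + j = p + 1`, and `0` otherwise. -/
def skewGram (p : ℕ) (ε : ℤˣ) : Matrix (Fin p) (Fin p) ℝ :=
  Matrix.of fun i j => if (i : ℕ) + j + 1 = p then ((ε : ℤ) : ℝ) else 0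

/-- The real Jordan block of size `2 p` for the eigenvalues `a ± b i`: its diagonal `2 × 2` blocks
are `!![a, b; -b, a]`, and those on the first superdiagonal are identity matrices. The index
`(i, 0)` is that of the basis vector `uᵢ`, the index `(i, 1)` that of `vᵢ`. -/
def realJordanBlock (a b : ℝ) (p : ℕ) : Matrix (Fin p × Fin 2) (Fin p × Fin 2) ℝ :=
  Matrix.of fun i j =>
    if i.1 = j.1 then (!![a, b; -b, a] : Matrix (Fin 2) (Fin 2) ℝ) i.2 j.2
    else if (i.1 : ℕ) + 1 = j.1 then (1 : Matrix (Fin 2) (Fin 2) ℝ) i.2 j.2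
    else 0

/-- The Gram matrix of `u₁, v₁, …, u_p, v_p` in which the only nonzero products are
`⟨uᵢ, uⱼ⟩ = 1` and `⟨vᵢ, vⱼ⟩ = -1` for `i + j = p + 1` (counted from `1`). -/
def realSkewGram (p : ℕ) : Matrix (Fin p × Fin 2) (Fin p × Fin 2) ℝ :=
  Matrix.of fun i j =>
    if (i.1 : ℕ) + j.1 + 1 = p then (!![1, 0; 0, -1] : Matrix (Fin 2) (Fin 2) ℝ) i.2 j.2
    else 0

section

variable {V : Type*} [AddCommGroup V] [Module ℝ V]

/-- The subspace `W` has a basis relative to which the scalar product `B` restricted to `W` has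
Gram matrix `G`, and `T` maps `W` to `W` with matrix `A` (columns are images of basis vectors). -/
def HasMatrices (B : LinearMap.BilinForm ℝ V) (T : V →ₗ[ℝ] V) (W : Submodule ℝ V)
    {ι : Type} [Fintype ι] (G A : Matrix ι ι ℝ) : Prop :=
  ∃ e : Module.Basis ι ℝ W,
    (∀ i j, B (e i : V) (e j : V) = G i j) ∧
    (∀ j, T (e j : V) = ∑ i, A i j • (e i : V))

/-- The subspace `W` is spanned by an adapted `p`-cycle of `T` of sign `ε` with eigenvalue `l`,
where `(l, p, ε)` is the triple `t`. For non-real `l` this is the real subspace spanned by the cycle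
and its conjugate; of the two conjugate eigenvalues the one with positive imaginary part is
recorded, and the sign is `1`. -/
def IsBlock (B : LinearMap.BilinForm ℝ V) (T : V →ₗ[ℝ] V) (W : Submodule ℝ V)
    (t : ℂ × ℕ × ℤˣ) : Prop :=
  0 < t.2.1 ∧
    ((t.1.im = 0 ∧ HasMatrices B T W (skewGram t.2.1 t.2.2) (jordanBlock t.1.re t.2.1)) ∨
      (0 < t.1.im ∧ t.2.2 = 1 ∧
        HasMatrices B T W (realSkewGram t.2.1) (realJordanBlock t.1.re t.1.im t.2.1)))

/-- The unordered list `m` of triples `(l, p, ε)`, with multiplicities, is a metric-Jordan canonical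
form of `T`: the space is the orthogonal direct sum of `T`-invariant subspaces, each spanned by an
adapted cycle, and `m` lists the triples of these cycles. -/
def IsMetricJordanForm (B : LinearMap.BilinForm ℝ V) (T : V →ₗ[ℝ] V)
    (m : Multiset (ℂ × ℕ × ℤˣ)) : Prop :=
  ∃ (k : ℕ) (W : Fin k → Submodule ℝ V) (t : Fin k → ℂ × ℕ × ℤˣ),
    DirectSum.IsInternal W ∧
    (∀ i j, i ≠ j → ∀ x ∈ W i, ∀ y ∈ W j, B x y = 0) ∧
    (∀ i, IsBlock B T (W i) (t i)) ∧
    m = Finset.univ.val.map t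

end

end MetricJordan

/-! A block of type `(l, p, ε)` is, over `K = ℝ` or `K = ℂ`, the algebra `K[X] / (X ^ p)` on which
`T` acts as multiplication by `X + l` and the scalar product of `f` and `g` is the real part of `ε`
times the coefficient of `X ^ (p - 1)` in `f * g`. Polynomials in `T` and their quadratic forms then
become computations with truncated polynomials, uniformly in the two cases.

Uniqueness is an inertia argument. Fix a triple `(l₀, p₀, ε₀)`, let `Q` be the real minimal
polynomial of `l₀`, and consider the form `ε₀ * B (Q(T) ^ (p₀ - 1) x) x` on the kernel of `Q(T) ^
p₀`. A block with another triple contributes only nonpositive values (`IsBlock.form_nonpos`); a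
block with this triple contributes positive index exactly one (`IsBlock.exists_form_pos`). The
multiplicity of the triple is therefore the positive index of a form which does not depend on the
decomposition; `IsBlockDecomposition.card_le` makes the comparison directly.

For existence, write `T = N + S` with `N` nilpotent, `S` semisimple, both polynomials in `T` and
hence self-adjoint and commuting. The kernel `U` of an irreducible factor of the minimal polynomial
of `S`, evaluated at `S`, is non-degenerate, and there `S` is a real scalar or `a + b J` with `J ^ 2
= -1`. So `U` is a vector space over `ℝ` or `ℂ` on which `N` is linear, and the cyclic span of a
suitable vector is a block (`exists_adapted_vector`). A block is non-degenerate, so its orthogonal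
complement is a complement, and induction on dimension finishes.

Finally, equal forms give blocks matched in pairs with identical matrices; sending adapted basis to
adapted basis yields the conjugating isometry. Conversely an isometry transports a decomposition. -/

namespace MetricJordan

open Polynomial

/-! ### Blocks in matrix form and as truncated polynomial algebras -/

section

variable {V : Type*} [AddCommGroup V] [Module ℝ V]

/-- A cyclic `K[X] / (X ^ p)`-module structure on `W`: `E n c` stands for the element `c * X ^ n`,
on which `T` acts as `l + X`, and the scalar product of `f` and `g` is the real part of the
coefficient of `X ^ (p - 1)` in `ε * f * g`. -/
structure IsCyclicModel {K : Type*} [RCLike K] (B : LinearMap.BilinForm ℝ V) (T : V →ₗ[ℝ] V)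
    (W : Submodule ℝ V) (l : K) (p : ℕ) (ε : ℤˣ) (E : ℕ → K →ₗ[ℝ] V) : Prop where
  pos : 0 < p
  eq_zero : ∀ n, p ≤ n → E n = 0
  map_apply : ∀ n c, T (E n c) = E n (l * c) + E (n + 1) c
  form_apply : ∀ m n c d, B (E m c) (E n d) =
    if m + n + 1 = p then RCLike.re (((ε : ℤ) : K) * (c * d)) else 0
  span : W = ⨆ n, LinearMap.range (E n)

theorem linearIndependent_of_gram (B : LinearMap.BilinForm ℝ V) {ι : Type*} [Fintype ι]
    (v : ι → V) (h : ∀ i, ∃ k, B (v i) (v k) ≠ 0 ∧ ∀ j, j ≠ i → B (v j) (v k) = 0) :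
    LinearIndependent ℝ v := by
  rw [Fintype.linearIndependent_iff]
  intro g hg i
  obtain ⟨k, hk, hk'⟩ := h i
  have h1 : B (∑ j, g j • v j) (v k) = 0 := by rw [hg]; simp
  rw [map_sum, LinearMap.sum_apply, Finset.sum_eq_single i] at h1
  · simpa [hk] using h1
  · intro j _ hj
    simp [hk' j hj]
  · simp

theorem hasMatrices_of_gram (B : LinearMap.BilinForm ℝ V) (T : V →ₗ[ℝ] V) (W : Submodule ℝ V)
    {ι : Type} [Fintype ι] (G A : Matrix ι ι ℝ) (v : ι → V)
    (hW : W = Submodule.span ℝ (Set.range v)) (hG : ∀ i j, B (v i) (v j) = G i j)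
    (hA : ∀ j, T (v j) = ∑ i, A i j • v i)
    (h : ∀ i, ∃ k, G i k ≠ 0 ∧ ∀ j, j ≠ i → G j k = 0) : HasMatrices B T W G A := by
  subst hW
  have hli : LinearIndependent ℝ v := linearIndependent_of_gram B v (by simpa only [hG] using h)
  refine ⟨Module.Basis.span hli, ?_, ?_⟩
  · intro i j
    simp only [Module.Basis.span_apply, hG]
  · intro j
    simp only [Module.Basis.span_apply, hA]

theorem sum_jordan {V : Type*} [AddCommMonoid V] {p : ℕ} (F G : Fin p → V) (j : Fin p) :
    ∑ i, (if i = j then F i else if (i : ℕ) + 1 = j then G i else 0) =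
      F j + if 0 < (j : ℕ) then G ⟨j - 1, by omega⟩ else 0 := by
  have h1 : ∀ i, (if i = j then F i else if (i : ℕ) + 1 = j then G i else 0) =
      (if i = j then F i else 0) + if (i : ℕ) + 1 = j then G i else 0 := by
    intro i
    by_cases h : i = j
    · subst h; simp
    · simp [h]
  rw [Finset.sum_congr rfl fun i _ => h1 i, Finset.sum_add_distrib]
  congr 1
  · simp
  · split_ifs with h
    · rw [Finset.sum_eq_single ⟨j - 1, by omega⟩]
      · rw [if_pos (by simp; omega)]
      · intro i _ hi
        rw [if_neg]
        intro h2
        exact hi (Fin.ext (by simp; omega))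
      · simp
    · exact Finset.sum_eq_zero fun i _ => if_neg (by omega)

theorem sum_jordanBlock (l : ℝ) {p : ℕ} (v : Fin p → V) (j : Fin p) :
    ∑ i, jordanBlock l p i j • v i =
      l • v j + if 0 < (j : ℕ) then v ⟨j - 1, by omega⟩ else 0 := by
  rw [← sum_jordan (fun i => l • v i) v j]
  refine Finset.sum_congr rfl fun i _ => ?_
  simp only [jordanBlock, Matrix.of_apply, ite_smul, one_smul, zero_smul]

theorem sum_realJordanBlock (a b : ℝ) {p : ℕ} (v : Fin p × Fin 2 → V) (j : Fin p) (s : Fin 2) :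
    ∑ i, realJordanBlock a b p i (j, s) • v i =
      (((!![a, b; -b, a] : Matrix (Fin 2) (Fin 2) ℝ) 0 s) • v (j, 0) +
        ((!![a, b; -b, a] : Matrix (Fin 2) (Fin 2) ℝ) 1 s) • v (j, 1)) +
      if 0 < (j : ℕ) then v (⟨j - 1, by omega⟩, s) else 0 := by
  rw [← sum_jordan (fun i => (((!![a, b; -b, a] : Matrix (Fin 2) (Fin 2) ℝ) 0 s) • v (i, 0) +
        ((!![a, b; -b, a] : Matrix (Fin 2) (Fin 2) ℝ) 1 s) • v (i, 1))) (fun i => v (i, s)) j,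
    Fintype.sum_prod_type]
  refine Finset.sum_congr rfl fun i _ => ?_
  rw [Fin.sum_univ_two]
  simp only [realJordanBlock, Matrix.of_apply]
  split_ifs
  · rfl
  · fin_cases s <;> simp [Matrix.one_apply]
  · simp

variable {B : LinearMap.BilinForm ℝ V} {T : V →ₗ[ℝ] V} {W : Submodule ℝ V}

theorem sign_ne_zero (ε : ℤˣ) : ((ε : ℤ) : ℝ) ≠ 0 := by
  exact_mod_cast ε.ne_zero

theorem IsCyclicModel.hasMatrices_real {l : ℝ} {p : ℕ} {ε : ℤˣ} {E : ℕ → ℝ →ₗ[ℝ] V}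
    (h : IsCyclicModel B T W l p ε E) :
    HasMatrices B T W (skewGram p ε) (jordanBlock l p) := by
  have hE : ∀ n c, E n c = c • E n 1 := fun n c => by rw [← map_smul]; simp
  have hp := h.pos
  -- The order is reversed: multiplication by `X` raises degree, while the nilpotent part of `T`
  -- lowers the index in the cycle.
  refine hasMatrices_of_gram B T W _ _ (fun j : Fin p => E (p - 1 - j) 1) ?_ ?_ ?_ ?_
  · rw [h.span]
    apply le_antisymm
    · refine iSup_le fun n => ?_
      rintro _ ⟨c, rfl⟩
      rw [hE]
      by_cases hn : n < p
      · refine Submodule.smul_mem _ _ (Submodule.subset_span ⟨⟨p - 1 - n, by omega⟩, ?_⟩)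
        simp only
        congr 2
        omega
      · rw [h.eq_zero n (by omega)]
        simp
    · rw [Submodule.span_le]
      rintro _ ⟨j, rfl⟩
      exact Submodule.mem_iSup_of_mem (p - 1 - j) ⟨1, rfl⟩
  · intro i j
    rw [h.form_apply]
    simp only [skewGram, Matrix.of_apply]
    refine if_congr ⟨fun _ => by omega, fun _ => by omega⟩ (by simp) rfl
  · intro j
    rw [sum_jordanBlock, h.map_apply, hE _ (l * 1), mul_one]
    congr 1
    split_ifs with hj
    · congr 2
      simp only
      omega
    · rw [h.eq_zero _ (by omega)]
      rfl
  · intro i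
    refine ⟨i.rev, ?_, ?_⟩
    · simp only [skewGram, Matrix.of_apply, Fin.val_rev]
      rw [if_pos (by omega)]
      exact sign_ne_zero ε
    · intro j hj
      simp only [skewGram, Matrix.of_apply, Fin.val_rev]
      rw [if_neg]
      intro h2
      exact hj (Fin.ext (by omega))

theorem IsCyclicModel.hasMatrices_complex {l : ℂ} {p : ℕ} {E : ℕ → ℂ →ₗ[ℝ] V}
    (h : IsCyclicModel B T W l p 1 E) :
    HasMatrices B T W (realSkewGram p) (realJordanBlock l.re l.im p) := by
  have hE : ∀ n c, E n c = c.re • E n 1 + (-c.im) • E n (-Complex.I) := fun n c => by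
    rw [← map_smul, ← map_smul, ← map_add]
    congr 1
    apply Complex.ext <;> simp
  have hp := h.pos
  -- The vectors `u` and `v` correspond to `1` and `-i`: then `⟨v, v⟩` comes from `(-i) ^ 2 = -1`,
  -- and `a + b i = a * 1 - b * (-i)` gives the prescribed `T u`; with `i` in place of `-i` the sign
  -- of `b` would be wrong.
  refine hasMatrices_of_gram B T W _ _
    (fun j : Fin p × Fin 2 => E (p - 1 - j.1) (![1, -Complex.I] j.2)) ?_ ?_ ?_ ?_
  · rw [h.span]
    apply le_antisymm
    · refine iSup_le fun n => ?_
      rintro _ ⟨c, rfl⟩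
      rw [hE]
      by_cases hn : n < p
      · have hn' : p - 1 - (p - 1 - n) = n := by omega
        refine Submodule.add_mem _
          (Submodule.smul_mem _ _ (Submodule.subset_span ⟨(⟨p - 1 - n, by omega⟩, 0), ?_⟩))
          (Submodule.smul_mem _ _ (Submodule.subset_span ⟨(⟨p - 1 - n, by omega⟩, 1), ?_⟩))
        · simp [hn']
        · simp [hn']
      · rw [h.eq_zero n (by omega)]
        simp
    · rw [Submodule.span_le]
      rintro _ ⟨j, rfl⟩
      exact Submodule.mem_iSup_of_mem (p - 1 - j.1) ⟨_, rfl⟩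
  · rintro ⟨i, s⟩ ⟨j, t⟩
    rw [h.form_apply]
    simp only [realSkewGram, Matrix.of_apply]
    refine if_congr ⟨fun _ => by omega, fun _ => by omega⟩ ?_ rfl
    fin_cases s <;> fin_cases t <;> simp
  · rintro ⟨j, s⟩
    rw [sum_realJordanBlock, h.map_apply, hE _ (l * _)]
    congr 1
    · fin_cases s <;> simp
    split_ifs with hj
    · congr 2
      simp only
      omega
    · rw [h.eq_zero _ (by simp only; omega)]
      rfl
  · rintro ⟨i, s⟩
    refine ⟨(i.rev, s), ?_, ?_⟩
    · simp only [realSkewGram, Matrix.of_apply, Fin.val_rev]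
      rw [if_pos (by omega)]
      fin_cases s <;> simp
    · rintro ⟨j, t⟩ hj
      simp only [realSkewGram, Matrix.of_apply, Fin.val_rev]
      split_ifs with h2
      · have : j = i := Fin.ext (by omega)
        subst this
        fin_cases s <;> fin_cases t <;> simp at hj ⊢
      · rfl

theorem HasMatrices.exists_isCyclicModel_real {l : ℝ} {p : ℕ} {ε : ℤˣ} (hp : 0 < p)
    (h : HasMatrices B T W (skewGram p ε) (jordanBlock l p)) :
    ∃ E : ℕ → ℝ →ₗ[ℝ] V, IsCyclicModel B T W l p ε E := by
  obtain ⟨e, he, hT⟩ := h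
  let E : ℕ → ℝ →ₗ[ℝ] V := fun n =>
    if h : n < p then LinearMap.toSpanSingleton ℝ V (e ⟨p - 1 - n, by omega⟩) else 0
  have hE : ∀ n (h : n < p) c, E n c = c • (e ⟨p - 1 - n, by omega⟩ : V) := fun n h c => by
    simp [E, h]
  have hE0 : ∀ n, p ≤ n → E n = 0 := fun n h => by simp [E, not_lt.2 h]
  refine ⟨E, hp, hE0, ?_, ?_, ?_⟩
  · intro n c
    by_cases hn : n < p
    · have h1 := hT ⟨p - 1 - n, by omega⟩
      rw [sum_jordanBlock l (fun i => (e i : V))] at h1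
      rw [hE n hn, map_smul, h1, hE n hn, smul_add, smul_smul, mul_comm]
      congr 1
      by_cases hn' : n + 1 < p
      · rw [hE _ hn', if_pos (by simp only; omega)]
        congr 4
      · rw [hE0 _ (by omega), if_neg (by simp only; omega)]
        simp
    · rw [hE0 n (by omega), hE0 (n + 1) (by omega)]
      simp
  · intro m n c d
    by_cases hm : m < p
    · by_cases hn : n < p
      · rw [hE m hm, hE n hn, map_smul, map_smul, LinearMap.smul_apply, he]
        simp only [skewGram, Matrix.of_apply, smul_ite, smul_zero]
        refine if_congr ⟨fun _ => by omega, fun _ => by omega⟩ ?_ rfl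
        simp; ring
      · rw [hE0 n (by omega), if_neg (by omega)]
        simp
    · rw [hE0 m (by omega), if_neg (by omega)]
      simp
  · apply le_antisymm
    · intro x hx
      have h1 := congrArg (Subtype.val) (e.sum_repr ⟨x, hx⟩)
      rw [Submodule.coe_sum] at h1
      rw [show x = _ from h1.symm]
      refine Submodule.sum_mem _ fun i _ => ?_
      refine Submodule.mem_iSup_of_mem (p - 1 - i) ⟨e.repr ⟨x, hx⟩ i, ?_⟩
      rw [hE _ (by omega), Submodule.coe_smul]
      congr 3
      ext
      simp only
      omega
    · refine iSup_le fun n => ?_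
      rintro _ ⟨c, rfl⟩
      by_cases hn : n < p
      · rw [hE n hn]
        exact W.smul_mem _ (e _).2
      · rw [hE0 n (by omega)]
        simp

theorem HasMatrices.exists_isCyclicModel_complex {l : ℂ} {p : ℕ} (hp : 0 < p)
    (h : HasMatrices B T W (realSkewGram p) (realJordanBlock l.re l.im p)) :
    ∃ E : ℕ → ℂ →ₗ[ℝ] V, IsCyclicModel B T W l p 1 E := by
  obtain ⟨e, he, hT⟩ := h
  let E : ℕ → ℂ →ₗ[ℝ] V := fun n =>
    if h : n < p then
      LinearMap.toSpanSingleton ℝ V (e (⟨p - 1 - n, by omega⟩, 0)) ∘ₗ Complex.reLm -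
      LinearMap.toSpanSingleton ℝ V (e (⟨p - 1 - n, by omega⟩, 1)) ∘ₗ Complex.imLm else 0
  have hE : ∀ n (h : n < p) c, E n c = c.re • (e (⟨p - 1 - n, by omega⟩, 0) : V) -
      c.im • (e (⟨p - 1 - n, by omega⟩, 1) : V) := fun n h c => by
    simp [E, h]
  have hE0 : ∀ n, p ≤ n → E n = 0 := fun n h => by simp [E, not_lt.2 h]
  refine ⟨E, hp, hE0, ?_, ?_, ?_⟩
  · intro n c
    by_cases hn : n < p
    · have h1 := fun s => hT (⟨p - 1 - n, by omega⟩, s)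
      simp only [sum_realJordanBlock l.re l.im (fun i => (e i : V))] at h1
      rw [hE n hn, map_sub, map_smul, map_smul, h1, h1, hE n hn]
      by_cases hn' : n + 1 < p
      · have h2 : p - 1 - n - 1 = p - 1 - (n + 1) := by omega
        simp only [hE _ hn', if_pos (show 0 < p - 1 - n by omega), h2]
        simp
        module
      · rw [hE0 _ (by omega)]
        simp only [if_neg (show ¬ 0 < p - 1 - n by omega)]
        simp
        module
    · rw [hE0 n (by omega), hE0 (n + 1) (by omega)]
      simp
  · intro m n c d
    by_cases hm : m < p
    · by_cases hn : n < p
      · rw [hE m hm, hE n hn]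
        simp only [map_sub, map_smul, LinearMap.sub_apply, LinearMap.smul_apply, he]
        simp only [realSkewGram, Matrix.of_apply]
        by_cases hmn : m + n + 1 = p
        · simp [hmn, show p - 1 - m + (p - 1 - n) + 1 = p by omega]
          ring
        · simp [hmn, show p - 1 - m + (p - 1 - n) + 1 ≠ p by omega]
      · rw [hE0 n (by omega), if_neg (by omega)]
        simp
    · rw [hE0 m (by omega), if_neg (by omega)]
      simp
  · apply le_antisymm
    · intro x hx
      have h1 := congrArg (Subtype.val) (e.sum_repr ⟨x, hx⟩)
      rw [Submodule.coe_sum] at h1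
      rw [show x = _ from h1.symm]
      refine Submodule.sum_mem _ fun i _ => ?_
      obtain ⟨i, s⟩ := i
      refine Submodule.mem_iSup_of_mem (p - 1 - i)
        ⟨e.repr ⟨x, hx⟩ (i, s) • (![1, -Complex.I] s), ?_⟩
      have h2 : (⟨p - 1 - (p - 1 - i), by omega⟩ : Fin p) = i := by
        ext
        simp only
        omega
      rw [hE _ (by omega), Submodule.coe_smul, h2]
      fin_cases s <;> simp
    · refine iSup_le fun n => ?_
      rintro _ ⟨c, rfl⟩
      by_cases hn : n < p
      · rw [hE n hn]
        exact W.sub_mem (W.smul_mem _ (e _).2) (W.smul_mem _ (e _).2)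
      · rw [hE0 n (by omega)]
        simp

end

/-! ### Polynomial calculus on a single block -/

section

variable {V : Type*} [AddCommGroup V] [Module ℝ V]
variable {B : LinearMap.BilinForm ℝ V} {T : V →ₗ[ℝ] V} {W : Submodule ℝ V}

namespace IsCyclicModel

variable {K : Type*} [RCLike K] {l : K} {p : ℕ} {ε : ℤˣ} {E : ℕ → K →ₗ[ℝ] V}

theorem lsum_monomial (E : ℕ → K →ₗ[ℝ] V) (n : ℕ) (c : K) : lsum E (monomial n c) = E n c := by
  simp [lsum_apply, sum_monomial_index]

theorem exists_eq_lsum (h : IsCyclicModel B T W l p ε E) {x : V} (hx : x ∈ W) :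
    ∃ f, x = lsum E f := by
  have h1 : W ≤ LinearMap.range (lsum E) := by
    rw [h.span]
    refine iSup_le fun n => ?_
    rintro _ ⟨c, rfl⟩
    exact ⟨monomial n c, lsum_monomial E n c⟩
  obtain ⟨f, hf⟩ := h1 hx
  exact ⟨f, hf.symm⟩

theorem lsum_mem (h : IsCyclicModel B T W l p ε E) (f : K[X]) : lsum E f ∈ W := by
  rw [h.span, lsum_apply]
  exact Submodule.sum_mem _ fun n _ => Submodule.mem_iSup_of_mem n ⟨_, rfl⟩

theorem map_lsum (h : IsCyclicModel B T W l p ε E) (f : K[X]) :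
    T (lsum E f) = lsum E ((X + C l) * f) := by
  induction f using Polynomial.induction_on' with
  | add f g hf hg => rw [map_add, map_add, hf, hg, mul_add, map_add]
  | monomial n c =>
    rw [lsum_monomial, h.map_apply, add_mul, X_mul_monomial, C_mul_monomial, map_add,
      lsum_monomial, lsum_monomial, add_comm]

theorem form_lsum (h : IsCyclicModel B T W l p ε E) (f g : K[X]) :
    B (lsum E f) (lsum E g) = RCLike.re (((ε : ℤ) : K) * (f * g).coeff (p - 1)) := by
  induction f using Polynomial.induction_on' with
  | add f f' hf hf' =>
    rw [map_add, map_add, LinearMap.add_apply, hf, hf', add_mul, coeff_add, mul_add, map_add]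
  | monomial m c =>
    induction g using Polynomial.induction_on' with
    | add f g hf hg =>
      rw [map_add, map_add, hf, hg, mul_add, coeff_add, mul_add, map_add]
    | monomial n d =>
      have := h.pos
      rw [lsum_monomial, lsum_monomial, h.form_apply, monomial_mul_monomial, coeff_monomial]
      by_cases hmn : m + n + 1 = p
      · rw [if_pos hmn, if_pos (by omega)]
      · rw [if_neg hmn, if_neg (by omega)]
        simp

theorem lsum_X_pow_mul (h : IsCyclicModel B T W l p ε E) (f : K[X]) :
    lsum E (X ^ p * f) = 0 := by
  induction f using Polynomial.induction_on' with
  | add f g hf hg => rw [mul_add, map_add, hf, hg, add_zero]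
  | monomial n c =>
    rw [X_pow_mul_monomial, lsum_monomial, h.eq_zero _ (by omega)]
    rfl

theorem X_pow_dvd_of_form_eq_zero (h : IsCyclicModel B T W l p ε E) {f : K[X]}
    (hf : ∀ y ∈ W, B (lsum E f) y = 0) : X ^ p ∣ f := by
  rw [X_pow_dvd_iff]
  intro d hd
  -- Pairing with `ε * conj(f_d) * X ^ (p - 1 - d)` isolates `‖f_d‖ ^ 2`; the lower coefficients are
  -- tested independently.
  have h1 := h.form_lsum f (C (((ε : ℤ) : K) * star (f.coeff d)) * X ^ (p - 1 - d))
  rw [hf _ (h.lsum_mem _), ← mul_assoc, coeff_mul_X_pow',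
    if_pos (by omega), show p - 1 - (p - 1 - d) = d by omega, coeff_mul_C] at h1
  have h2 : ((ε : ℤ) : K) * (f.coeff d * (((ε : ℤ) : K) * star (f.coeff d))) =
      f.coeff d * star (f.coeff d) := by
    rcases Int.units_eq_one_or ε with rfl | rfl <;> simp
  rw [h2, RCLike.star_def, RCLike.mul_conj] at h1
  have h3 : ‖f.coeff d‖ ^ 2 = 0 := by
    rw [h1]
    exact_mod_cast (RCLike.ofReal_re (K := K) _).symm
  simpa using h3

theorem lsum_eq_zero_iff (h : IsCyclicModel B T W l p ε E) {f : K[X]} :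
    lsum E f = 0 ↔ X ^ p ∣ f := by
  refine ⟨fun hf => h.X_pow_dvd_of_form_eq_zero fun y _ => by rw [hf]; simp, ?_⟩
  rintro ⟨g, rfl⟩
  exact h.lsum_X_pow_mul g

theorem eq_zero_of_orthogonal (h : IsCyclicModel B T W l p ε E) {x : V} (hx : x ∈ W)
    (h0 : ∀ y ∈ W, B x y = 0) : x = 0 := by
  obtain ⟨f, rfl⟩ := h.exists_eq_lsum hx
  exact h.lsum_eq_zero_iff.2 (h.X_pow_dvd_of_form_eq_zero h0)

/-- Since `T` is multiplication by `X + l`, the operator `g(T)` is multiplication by `g(X + l)`, the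
Taylor expansion of `g` at `l`. -/
theorem aeval_lsum (h : IsCyclicModel B T W l p ε E) (g : ℝ[X]) (f : K[X]) :
    aeval T g (lsum E f) = lsum E (taylor l (g.map (algebraMap ℝ K)) * f) := by
  induction g using Polynomial.induction_on' generalizing f with
  | add g g' hg hg' =>
    rw [map_add, LinearMap.add_apply, hg, hg', Polynomial.map_add, map_add, add_mul, map_add]
  | monomial n a =>
    have h1 : ∀ (n : ℕ) (f : K[X]), (T ^ n) (lsum E f) = lsum E ((X + C l) ^ n * f) := by
      intro n
      induction n with
      | zero => simp
      | succ n ih =>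
        intro f
        rw [pow_succ, Module.End.mul_apply, h.map_lsum, ih, pow_succ, mul_assoc]
    rw [aeval_monomial, Module.algebraMap_end_eq_smul_id, Module.End.mul_apply, h1,
      LinearMap.smul_apply, LinearMap.id_apply, ← map_smul, map_monomial, taylor_monomial]
    congr 1
    rw [mul_assoc]
    ext n
    simp [Algebra.smul_def]

variable {Q : ℝ[X]}

/-- When `Q(l) ≠ 0`, the polynomial `Q(X + l)` is a unit modulo `X ^ p`. -/
theorem eq_zero_of_aeval_pow (h : IsCyclicModel B T W l p ε E)
    (hQ : (Q.map (algebraMap ℝ K)).eval l ≠ 0) {n : ℕ} {x : V} (hx : x ∈ W)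
    (h0 : aeval T (Q ^ n) x = 0) : x = 0 := by
  obtain ⟨f, rfl⟩ := h.exists_eq_lsum hx
  rw [h.aeval_lsum, h.lsum_eq_zero_iff, Polynomial.map_pow, taylor_pow] at h0
  rw [h.lsum_eq_zero_iff]
  have hX : ¬ X ∣ taylor l (Q.map (algebraMap ℝ K)) ^ n := by
    intro hd
    have := Prime.dvd_of_dvd_pow prime_X hd
    rw [X_dvd_iff, taylor_coeff_zero] at this
    exact hQ this
  exact prime_X.pow_dvd_of_dvd_mul_left _ hX h0

theorem exists_taylor_eq (hQ : (Q.map (algebraMap ℝ K)).eval l = 0) :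
    ∃ u : K[X], taylor l (Q.map (algebraMap ℝ K)) = X * u ∧
      u.coeff 0 = ((derivative Q).map (algebraMap ℝ K)).eval l := by
  have h1 : X ∣ taylor l (Q.map (algebraMap ℝ K)) := by
    rw [X_dvd_iff, taylor_coeff_zero, hQ]
  obtain ⟨u, hu⟩ := h1
  refine ⟨u, hu, ?_⟩
  rw [← derivative_map, ← taylor_coeff_one, hu, coeff_X_mul]

/-- At a simple root, `Q(X + l)` is `X` times a unit. If `p < p₀`, then `Q(T) ^ (p₀ - 1)` already
kills the block. If `p > p₀`, the kernel of `Q(T) ^ p₀` consists of multiples of `X ^ (p - p₀)`, and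
two such factors together with `X ^ (p₀ - 1)` exceed degree `p - 1`. -/
theorem form_eq_zero_of_ne (h : IsCyclicModel B T W l p ε E)
    (hQ : (Q.map (algebraMap ℝ K)).eval l = 0)
    (hQ' : ((derivative Q).map (algebraMap ℝ K)).eval l ≠ 0) {p₀ : ℕ} (hp₀ : 0 < p₀)
    (hne : p ≠ p₀) {x : V} (hx : x ∈ W) (h0 : aeval T (Q ^ p₀) x = 0) :
    B (aeval T (Q ^ (p₀ - 1)) x) x = 0 := by
  obtain ⟨u, hu, hu0⟩ := exists_taylor_eq hQ
  obtain ⟨f, rfl⟩ := h.exists_eq_lsum hx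
  rw [h.aeval_lsum, h.lsum_eq_zero_iff, Polynomial.map_pow, taylor_pow, hu, mul_pow] at h0
  rw [h.aeval_lsum, Polynomial.map_pow, taylor_pow, hu, mul_pow, h.form_lsum]
  have hp := h.pos
  suffices h2 : X ^ p ∣ X ^ (p₀ - 1) * u ^ (p₀ - 1) * f * f by
    rw [X_pow_dvd_iff.1 h2 _ (by omega)]
    simp
  rcases lt_or_gt_of_ne hne with hlt | hgt
  · refine dvd_mul_of_dvd_left (dvd_mul_of_dvd_left (dvd_mul_of_dvd_left ?_ _) _) _
    exact pow_dvd_pow _ (by omega)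
  · have hX : ¬ X ∣ u ^ p₀ := fun hd => by
      have := Prime.dvd_of_dvd_pow prime_X hd
      rw [X_dvd_iff, hu0] at this
      exact hQ' this
    rw [mul_assoc, show p = p₀ + (p - p₀) by omega, pow_add] at h0
    have h3 := (mul_dvd_mul_iff_left (pow_ne_zero _ X_ne_zero)).1 h0
    obtain ⟨g, rfl⟩ := prime_X.pow_dvd_of_dvd_mul_left _ hX h3
    refine ⟨u ^ (p₀ - 1) * X ^ (p - p₀ - 1) * g * g, ?_⟩
    have h4 : (X : K[X]) ^ (p₀ - 1) * (X ^ (p - p₀) * X ^ (p - p₀)) =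
        X ^ p * X ^ (p - p₀ - 1) := by
      rw [← pow_add, ← pow_add, ← pow_add]
      congr 1
      omega
    linear_combination (u ^ (p₀ - 1) * g * g) * h4

/-- Only the constant coefficient of `f` survives, so over `K` the form has rank at most one. -/
theorem form_aeval_pow (h : IsCyclicModel B T W l p ε E)
    (hQ : (Q.map (algebraMap ℝ K)).eval l = 0) (f : K[X]) :
    B (aeval T (Q ^ (p - 1)) (lsum E f)) (lsum E f) = RCLike.re (((ε : ℤ) : K) *
      (((derivative Q).map (algebraMap ℝ K)).eval l ^ (p - 1) * f.coeff 0 ^ 2)) := by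
  obtain ⟨u, hu, hu0⟩ := exists_taylor_eq hQ
  rw [h.aeval_lsum, Polynomial.map_pow, taylor_pow, hu, mul_pow, h.form_lsum, ← hu0]
  have h1 : X ^ (p - 1) * u ^ (p - 1) * f * f = (u ^ (p - 1) * f ^ 2) * X ^ (p - 1) := by ring
  rw [h1, coeff_mul_X_pow', if_pos le_rfl, Nat.sub_self]
  simp only [coeff_zero_eq_eval_zero, eval_mul, eval_pow]

theorem aeval_pow_eq_zero (h : IsCyclicModel B T W l p ε E)
    (hQ : (Q.map (algebraMap ℝ K)).eval l = 0) (f : K[X]) :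
    aeval T (Q ^ p) (lsum E f) = 0 := by
  obtain ⟨u, hu, -⟩ := exists_taylor_eq hQ
  rw [h.aeval_lsum, Polynomial.map_pow, taylor_pow, hu, mul_pow, h.lsum_eq_zero_iff, mul_assoc]
  exact dvd_mul_right _ _

theorem form_lsum_X_pow (h : IsCyclicModel B T W l p ε E) (f : K[X]) (c : K) :
    B (lsum E f) (lsum E (C c * X ^ (p - 1))) =
      RCLike.re (((ε : ℤ) : K) * (f.coeff 0 * c)) := by
  rw [h.form_lsum, ← mul_assoc, coeff_mul_X_pow', if_pos le_rfl, Nat.sub_self, coeff_mul_C]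

end IsCyclicModel

/-! ### The sign of the test form on each block -/

/-- The minimal polynomial over `ℝ` of the complex number `l`. -/
noncomputable def realMinpoly (l : ℂ) : ℝ[X] :=
  if l.im = 0 then X - C l.re else (X - C l.re) ^ 2 + C (l.im ^ 2)

/-- The triples which may occur in a metric-Jordan canonical form. -/
def IsAdmissible (t : ℂ × ℕ × ℤˣ) : Prop :=
  0 < t.2.1 ∧ (t.1.im = 0 ∨ (0 < t.1.im ∧ t.2.2 = 1))

theorem IsBlock.isAdmissible {t : ℂ × ℕ × ℤˣ} (h : IsBlock B T W t) : IsAdmissible t :=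
  ⟨h.1, h.2.imp (fun h => h.1) fun h => ⟨h.1, h.2.1⟩⟩

theorem eval_realMinpoly_eq_zero_iff {l : ℂ} {r : ℝ} (hl : 0 ≤ l.im) :
    ((realMinpoly l).map (algebraMap ℝ ℝ)).eval r = 0 ↔ l = r := by
  rw [Algebra.algebraMap_self, Polynomial.map_id, realMinpoly]
  split_ifs with h
  · simp [sub_eq_zero, Complex.ext_iff, h, eq_comm]
  · simp only [eval_add, eval_pow, eval_sub, eval_X, eval_C, Complex.ext_iff, Complex.ofReal_im, h,
      and_false, iff_false]
    have : 0 < l.im ^ 2 := by positivity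
    nlinarith [sq_nonneg (r - l.re)]

theorem eval_map_realMinpoly_eq_zero_iff {l c : ℂ} (hl : 0 ≤ l.im) (hc : 0 < c.im) :
    ((realMinpoly l).map (algebraMap ℝ ℂ)).eval c = 0 ↔ l = c := by
  rw [realMinpoly]
  split_ifs with h
  · simp [sub_eq_zero, Complex.ext_iff, h, eq_comm]
  · have h1 : eval c (Polynomial.map (algebraMap ℝ ℂ) ((X - C l.re) ^ 2 + C (l.im ^ 2))) =
        (c - l) * (c - star l) := by
      simp only [Polynomial.map_add, Polynomial.map_pow, Polynomial.map_sub, map_X, map_C,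
        eval_add, eval_pow, eval_sub, eval_X, eval_C, Complex.coe_algebraMap]
      apply Complex.ext <;> simp [pow_two] <;> ring
    rw [h1, mul_eq_zero, sub_eq_zero, sub_eq_zero, eq_comm (a := l), or_iff_left_iff_imp]
    intro h2
    have := congrArg Complex.im h2
    simp at this
    linarith

theorem eval_derivative_realMinpoly_real {l : ℂ} (hl : l.im = 0) (r : ℝ) :
    ((derivative (realMinpoly l)).map (algebraMap ℝ ℝ)).eval r = 1 := by
  simp [realMinpoly, hl]

theorem eval_derivative_realMinpoly_complex {l : ℂ} (hl : 0 < l.im) :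
    ((derivative (realMinpoly l)).map (algebraMap ℝ ℂ)).eval l ≠ 0 := by
  rw [realMinpoly, if_neg hl.ne']
  simp only [derivative_add, derivative_C, add_zero, derivative_X_sub_C_pow,
    Polynomial.map_mul, Polynomial.map_sub, Polynomial.map_pow, map_X, map_C, eval_mul, eval_sub,
    eval_pow, eval_X, eval_C, Complex.coe_algebraMap]
  simp
  intro h
  have := congrArg Complex.im h
  simp at this
  exact hl.ne' this

/-- A different eigenvalue forces `x = 0`; the same eigenvalue with a different length makes the
form vanish; the same real eigenvalue and length leave only the opposite sign. For non-real
eigenvalues the sign is always `1`, so this last case does not arise. -/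
theorem IsBlock.form_nonpos {t t₀ : ℂ × ℕ × ℤˣ} (h : IsBlock B T W t) (h₀ : IsAdmissible t₀)
    (hne : t ≠ t₀) {x : V} (hx : x ∈ W) (h0 : aeval T (realMinpoly t₀.1 ^ t₀.2.1) x = 0) :
    ((t₀.2.2 : ℤ) : ℝ) * B (aeval T (realMinpoly t₀.1 ^ (t₀.2.1 - 1)) x) x ≤ 0 := by
  obtain ⟨l, p, ε⟩ := t
  obtain ⟨l₀, p₀, ε₀⟩ := t₀
  simp only [IsBlock, IsAdmissible] at *
  have him : 0 ≤ l₀.im := h₀.2.elim (fun h => h.ge) fun h => h.1.le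
  obtain ⟨hp, ⟨hl, hM⟩ | ⟨hl, rfl, hM⟩⟩ := h
  · obtain ⟨E, hE⟩ := hM.exists_isCyclicModel_real hp
    have hll : l = (l.re : ℂ) := Complex.ext (by simp) (by simp [hl])
    by_cases h1 : l₀ = l
    · have hQ := (eval_realMinpoly_eq_zero_iff him).2 (h1.trans hll)
      have hQ' := eval_derivative_realMinpoly_real (l := l₀) (by rw [h1, hl]) l.re
      by_cases h2 : p = p₀
      · subst h2
        have h3 : ε₀ = -ε :=
          Int.units_ne_iff_eq_neg.1 fun h => hne (by rw [h, h1])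
        obtain ⟨f, rfl⟩ := hE.exists_eq_lsum hx
        rw [hE.form_aeval_pow hQ, hQ', h3]
        rcases Int.units_eq_one_or ε with rfl | rfl <;> simp <;> positivity
      · rw [hE.form_eq_zero_of_ne hQ (by rw [hQ']; exact one_ne_zero) h₀.1 h2 hx h0, mul_zero]
    · rw [hE.eq_zero_of_aeval_pow (fun h => h1 ?_) hx h0]
      · simp
      · exact ((eval_realMinpoly_eq_zero_iff him).1 h).trans hll.symm
  · obtain ⟨E, hE⟩ := hM.exists_isCyclicModel_complex hp
    by_cases h1 : l₀ = l
    · subst h1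
      have hQ := (eval_map_realMinpoly_eq_zero_iff him hl).2 rfl
      have hQ' := eval_derivative_realMinpoly_complex hl
      have h2 : p ≠ p₀ := by
        rintro rfl
        rcases h₀.2 with h3 | h3
        · exact hl.ne' h3
        · exact hne (by rw [h3.2])
      rw [hE.form_eq_zero_of_ne hQ hQ' h₀.1 h2 hx h0, mul_zero]
    · rw [hE.eq_zero_of_aeval_pow
        (fun h => h1 ((eval_map_realMinpoly_eq_zero_iff him hl).1 h)) hx h0]
      simp

/-- The positive index is exactly one: there is a positive vector `y` in the kernel, and the form is
nonpositive on the hyperplane orthogonal to `z`. -/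
theorem IsBlock.exists_form_pos {t : ℂ × ℕ × ℤˣ} (h : IsBlock B T W t) :
    (∃ y ∈ W, aeval T (realMinpoly t.1 ^ t.2.1) y = 0 ∧
      0 < ((t.2.2 : ℤ) : ℝ) * B (aeval T (realMinpoly t.1 ^ (t.2.1 - 1)) y) y) ∧
    ∃ z ∈ W, ∀ x ∈ W, B x z = 0 →
      ((t.2.2 : ℤ) : ℝ) * B (aeval T (realMinpoly t.1 ^ (t.2.1 - 1)) x) x ≤ 0 := by
  obtain ⟨l, p, ε⟩ := t
  simp only [IsBlock] at *
  obtain ⟨hp, ⟨hl, hM⟩ | ⟨hl, rfl, hM⟩⟩ := h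
  · obtain ⟨E, hE⟩ := hM.exists_isCyclicModel_real hp
    have hll : l = (l.re : ℂ) := Complex.ext (by simp) (by simp [hl])
    have hQ := (eval_realMinpoly_eq_zero_iff hl.ge).2 hll
    have hQ' := eval_derivative_realMinpoly_real hl l.re
    refine ⟨⟨lsum E 1, hE.lsum_mem _, hE.aeval_pow_eq_zero hQ _, ?_⟩,
      lsum E (C 1 * X ^ (p - 1)), hE.lsum_mem _, ?_⟩
    · rw [hE.form_aeval_pow hQ, hQ']
      rcases Int.units_eq_one_or ε with rfl | rfl <;> simp
    · intro x hx hxz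
      obtain ⟨f, rfl⟩ := hE.exists_eq_lsum hx
      rw [hE.form_lsum_X_pow] at hxz
      have h0 : f.coeff 0 = 0 := by simpa using hxz
      rw [hE.form_aeval_pow hQ, h0]
      simp
  · obtain ⟨E, hE⟩ := hM.exists_isCyclicModel_complex hp
    have hQ := (eval_map_realMinpoly_eq_zero_iff hl.le hl).2 rfl
    have hQ' := eval_derivative_realMinpoly_complex hl
    -- With this square root the form is `Re ((γ * f₀) ^ 2)`, where `f₀` is the constant
    -- coefficient. Orthogonality to `z` says `Re (γ * f₀) = 0`, which leaves `-(Im (γ * f₀)) ^ 2`.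
    obtain ⟨γ, hγ⟩ := IsAlgClosed.exists_pow_nat_eq
      (((derivative (realMinpoly l)).map (algebraMap ℝ ℂ)).eval l ^ (p - 1)) (n := 2) (by norm_num)
    have hγ0 : γ ≠ 0 := by
      rintro rfl
      exact pow_ne_zero (p - 1) hQ' (by rw [← hγ]; simp)
    refine ⟨⟨lsum E (C γ⁻¹), hE.lsum_mem _, hE.aeval_pow_eq_zero hQ _, ?_⟩,
      lsum E (C γ * X ^ (p - 1)), hE.lsum_mem _, ?_⟩
    · rw [hE.form_aeval_pow hQ, ← hγ, coeff_C_zero, ← mul_pow, mul_inv_cancel₀ hγ0]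
      simp
    · intro x hx hxz
      obtain ⟨f, rfl⟩ := hE.exists_eq_lsum hx
      rw [hE.form_lsum_X_pow] at hxz
      have h0 : (γ * f.coeff 0).re = 0 := by simpa [mul_comm γ] using hxz
      rw [hE.form_aeval_pow hQ, ← hγ, ← mul_pow]
      simp only [Units.val_one, Int.cast_one, one_mul]
      rw [pow_two]
      simp only [RCLike.re_to_complex, Complex.mul_re (γ * f.coeff 0), h0]
      nlinarith [sq_nonneg (γ * f.coeff 0).im]

theorem IsBlock.map_mem {t : ℂ × ℕ × ℤˣ} (h : IsBlock B T W t) {x : V} (hx : x ∈ W) :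
    T x ∈ W := by
  obtain ⟨hp, ⟨hl, hM⟩ | ⟨hl, hε, hM⟩⟩ := h
  · obtain ⟨E, hE⟩ := hM.exists_isCyclicModel_real hp
    obtain ⟨f, rfl⟩ := hE.exists_eq_lsum hx
    rw [hE.map_lsum]
    exact hE.lsum_mem _
  · obtain ⟨E, hE⟩ := hM.exists_isCyclicModel_complex hp
    obtain ⟨f, rfl⟩ := hE.exists_eq_lsum hx
    rw [hE.map_lsum]
    exact hE.lsum_mem _

theorem IsBlock.eq_zero_of_orthogonal {t : ℂ × ℕ × ℤˣ} (h : IsBlock B T W t) {x : V} (hx : x ∈ W)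
    (h0 : ∀ y ∈ W, B x y = 0) : x = 0 := by
  obtain ⟨hp, ⟨hl, hM⟩ | ⟨hl, hε, hM⟩⟩ := h
  · obtain ⟨E, hE⟩ := hM.exists_isCyclicModel_real hp
    exact hE.eq_zero_of_orthogonal hx h0
  · obtain ⟨E, hE⟩ := hM.exists_isCyclicModel_complex hp
    exact hE.eq_zero_of_orthogonal hx h0

end

/-! ### Orthogonal decompositions and uniqueness of the form -/

section

variable {V : Type*} [AddCommGroup V] [Module ℝ V]
variable {B : LinearMap.BilinForm ℝ V} {T : V →ₗ[ℝ] V}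

theorem aeval_mem_of_map_mem {W : Submodule ℝ V} (hW : ∀ x ∈ W, T x ∈ W) (g : ℝ[X]) {x : V}
    (hx : x ∈ W) : aeval T g x ∈ W := by
  have h1 : ∀ n : ℕ, (T ^ n) x ∈ W := by
    intro n
    induction n with
    | zero => simpa
    | succ n ih =>
      rw [pow_succ', Module.End.mul_apply]
      exact hW _ ih
  induction g using Polynomial.induction_on' with
  | add g g' hg hg' =>
    rw [map_add, LinearMap.add_apply]
    exact W.add_mem hg hg'
  | monomial n a =>
    rw [aeval_monomial, Module.algebraMap_end_eq_smul_id, Module.End.mul_apply,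
      LinearMap.smul_apply, LinearMap.id_apply]
    exact W.smul_mem _ (h1 n)

/-- The space is the orthogonal sum of the subspaces `W i`, where `W i` is spanned by an adapted
cycle with triple `t i`. -/
structure IsBlockDecomposition {ι : Type*} (B : LinearMap.BilinForm ℝ V) (T : V →ₗ[ℝ] V)
    (W : ι → Submodule ℝ V) (t : ι → ℂ × ℕ × ℤˣ) : Prop where
  orthogonal : ∀ i j, i ≠ j → ∀ x ∈ W i, ∀ y ∈ W j, B x y = 0
  isBlock : ∀ i, IsBlock B T (W i) (t i)
  iSup_eq_top : ⨆ i, W i = ⊤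

namespace IsBlockDecomposition

variable {ι : Type*} {W : ι → Submodule ℝ V} {t : ι → ℂ × ℕ × ℤˣ}

theorem aeval_mem (h : IsBlockDecomposition B T W t) (g : ℝ[X]) {i : ι} {x : V} (hx : x ∈ W i) :
    aeval T g x ∈ W i :=
  aeval_mem_of_map_mem (fun _ hx => (h.isBlock i).map_mem hx) g hx

/-- Orthogonality and the non-degeneracy of each block already force independence, so only the
spanning condition has to be carried along. -/
theorem iSupIndep (h : IsBlockDecomposition B T W t) : iSupIndep W := by
  intro i
  rw [Submodule.disjoint_def]
  intro x hx hx'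
  refine (h.isBlock i).eq_zero_of_orthogonal hx fun y hy => ?_
  have h1 : ⨆ (j) (_ : j ≠ i), W j ≤ LinearMap.ker (B.flip y) :=
    iSup₂_le fun j hj z hz => h.orthogonal j i hj z hz y hy
  exact h1 hx'

variable [Fintype ι]

theorem exists_eq_sum (h : IsBlockDecomposition B T W t) (x : V) :
    ∃ f : ι → V, (∀ i, f i ∈ W i) ∧ x = ∑ i, f i := by
  have hx : x ∈ ⨆ i, W i := by rw [h.iSup_eq_top]; trivial
  obtain ⟨f, hf, rfl⟩ := (Submodule.mem_iSup_iff_exists_finsupp W x).1 hx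
  exact ⟨f, hf, Finsupp.sum_fintype _ _ fun _ => rfl⟩

theorem form_sum_left (h : IsBlockDecomposition B T W t) {f : ι → V} (hf : ∀ i, f i ∈ W i) {i : ι}
    {y : V} (hy : y ∈ W i) : B (∑ j, f j) y = B (f i) y := by
  rw [map_sum, LinearMap.sum_apply]
  refine Finset.sum_eq_single i (fun j _ hj => ?_) (by simp)
  exact h.orthogonal j i hj _ (hf j) _ hy

theorem eq_zero_of_sum_eq_zero (h : IsBlockDecomposition B T W t) {f : ι → V}
    (hf : ∀ i, f i ∈ W i) (h0 : ∑ i, f i = 0) (i : ι) : f i = 0 := by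
  refine (h.isBlock i).eq_zero_of_orthogonal (hf i) fun y hy => ?_
  rw [← h.form_sum_left hf hy, h0]
  simp

theorem form_aeval_sum (h : IsBlockDecomposition B T W t) {f : ι → V} (hf : ∀ i, f i ∈ W i)
    (g : ℝ[X]) : B (aeval T g (∑ i, f i)) (∑ i, f i) = ∑ i, B (aeval T g (f i)) (f i) := by
  rw [map_sum, map_sum]
  exact Finset.sum_congr rfl fun i _ => h.form_sum_left (fun j => h.aeval_mem g (hf j)) (hf i)

/-- The vectors `y i` of the first decomposition span a space on which the test form is positive
definite, while the functionals `B · (z j)` of the second cut out a region where the form is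
nonpositive on the kernel of `Q(T) ^ p₀`. Hence these functionals are jointly injective on the span.
-/
theorem card_le [DecidableEq (ℂ × ℕ × ℤˣ)] (h : IsBlockDecomposition B T W t) {κ : Type*}
    [Fintype κ] {W' : κ → Submodule ℝ V} {t' : κ → ℂ × ℕ × ℤˣ}
    (h' : IsBlockDecomposition B T W' t') {t₀ : ℂ × ℕ × ℤˣ} (h₀ : IsAdmissible t₀) :
    Fintype.card {i // t i = t₀} ≤ Fintype.card {j // t' j = t₀} := by
  classical
  set Q := realMinpoly t₀.1 with hQ
  have hy : ∀ i, ∃ y ∈ W i, t i = t₀ → aeval T (Q ^ t₀.2.1) y = 0 ∧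
      0 < ((t₀.2.2 : ℤ) : ℝ) * B (aeval T (Q ^ (t₀.2.1 - 1)) y) y := by
    intro i
    by_cases hi : t i = t₀
    · obtain ⟨⟨y, hy, hy'⟩, -⟩ := (h.isBlock i).exists_form_pos
      rw [hi] at hy'
      exact ⟨y, hy, fun _ => hy'⟩
    · exact ⟨0, zero_mem _, fun h => absurd h hi⟩
  choose y hyW hy using hy
  have hz : ∀ j, ∃ z ∈ W' j, t' j = t₀ → ∀ x ∈ W' j, B x z = 0 →
      ((t₀.2.2 : ℤ) : ℝ) * B (aeval T (Q ^ (t₀.2.1 - 1)) x) x ≤ 0 := by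
    intro j
    by_cases hj : t' j = t₀
    · obtain ⟨-, z, hz, hz'⟩ := (h'.isBlock j).exists_form_pos
      rw [hj] at hz'
      exact ⟨z, hz, fun _ => hz'⟩
    · exact ⟨0, zero_mem _, fun h => absurd h hj⟩
  choose z hzW hz using hz
  let Y : ({i // t i = t₀} → ℝ) →ₗ[ℝ] V :=
    Fintype.linearCombination ℝ fun i => y i.1
  let Z : V →ₗ[ℝ] ({j // t' j = t₀} → ℝ) := LinearMap.pi fun j => B.flip (z j.1)
  have hinj : Function.Injective (Z ∘ₗ Y) := by
    rw [← LinearMap.ker_eq_bot, LinearMap.ker_eq_bot']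
    intro c hc
    let c' : ι → ℝ := fun i => if hi : t i = t₀ then c ⟨i, hi⟩ else 0
    have hYc : Y c = ∑ i, c' i • y i := by
      rw [Fintype.linearCombination_apply]
      rw [← Fintype.sum_subtype_add_sum_subtype (fun i => t i = t₀) (fun i => c' i • y i)]
      rw [Finset.sum_eq_zero (s := Finset.univ (α := {i // ¬ t i = t₀})), add_zero]
      · refine Finset.sum_congr rfl fun i _ => ?_
        simp [c', i.2]
      · intro i _
        simp [c', i.2]
    have hmem : ∀ i, c' i • y i ∈ W i := fun i => (W i).smul_mem _ (hyW i)
    have hF := h.form_aeval_sum hmem (Q ^ (t₀.2.1 - 1))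
    have hker : aeval T (Q ^ t₀.2.1) (Y c) = 0 := by
      rw [hYc, map_sum]
      refine Finset.sum_eq_zero fun i _ => ?_
      by_cases hi : t i = t₀
      · rw [map_smul, (hy i hi).1, smul_zero]
      · simp [c', hi]
    have hle : ((t₀.2.2 : ℤ) : ℝ) * B (aeval T (Q ^ (t₀.2.1 - 1)) (Y c)) (Y c) ≤ 0 := by
      obtain ⟨f, hf, hYf⟩ := h'.exists_eq_sum (Y c)
      rw [hYf, map_sum] at hker
      rw [hYf, h'.form_aeval_sum hf, Finset.mul_sum]
      -- The blocks are invariant and independent, so each component of a kernel vector lies in the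
      -- kernel, as `IsBlock.form_nonpos` requires.
      have hk := h'.eq_zero_of_sum_eq_zero (fun j => h'.aeval_mem _ (hf j)) hker
      refine Finset.sum_nonpos fun j _ => ?_
      by_cases hj : t' j = t₀
      · refine hz j hj _ (hf j) ?_
        have := congrFun hc ⟨j, hj⟩
        simp only [LinearMap.comp_apply] at this
        rw [← h'.form_sum_left hf (hzW j), ← hYf]
        exact this
      · exact (h'.isBlock j).form_nonpos h₀ hj (hf j) (hk j)
    rw [hYc, hF, Finset.mul_sum] at hle
    have hterm : ∀ i, ((t₀.2.2 : ℤ) : ℝ) *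
        B (aeval T (Q ^ (t₀.2.1 - 1)) (c' i • y i)) (c' i • y i) = c' i ^ 2 *
        (((t₀.2.2 : ℤ) : ℝ) * B (aeval T (Q ^ (t₀.2.1 - 1)) (y i)) (y i)) := by
      intro i
      simp only [map_smul, LinearMap.smul_apply, smul_eq_mul]
      ring
    simp only [hterm] at hle
    have hnn : ∀ i ∈ Finset.univ, 0 ≤ c' i ^ 2 *
        (((t₀.2.2 : ℤ) : ℝ) * B (aeval T (Q ^ (t₀.2.1 - 1)) (y i)) (y i)) := by
      intro i _
      by_cases hi : t i = t₀
      · exact mul_nonneg (sq_nonneg _) (hy i hi).2.le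
      · simp [c', hi]
    have hz0 := (Finset.sum_eq_zero_iff_of_nonneg hnn).1 (le_antisymm hle (Finset.sum_nonneg hnn))
    funext i
    have h1 := (mul_eq_zero.1 (hz0 i.1 (Finset.mem_univ _))).resolve_right (hy i.1 i.2).2.ne'
    simpa [c', i.2] using h1
  have := LinearMap.finrank_le_finrank_of_injective hinj
  simpa using this

end IsBlockDecomposition

theorem isMetricJordanForm_iff {m : Multiset (ℂ × ℕ × ℤˣ)} : IsMetricJordanForm B T m ↔
    ∃ (k : ℕ) (W : Fin k → Submodule ℝ V) (t : Fin k → ℂ × ℕ × ℤˣ),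
      IsBlockDecomposition B T W t ∧ m = Finset.univ.val.map t := by
  constructor
  · rintro ⟨k, W, t, h1, h2, h3, h4⟩
    rw [DirectSum.isInternal_submodule_iff_iSupIndep_and_iSup_eq_top] at h1
    exact ⟨k, W, t, ⟨h2, h3, h1.2⟩, h4⟩
  · rintro ⟨k, W, t, h, h4⟩
    refine ⟨k, W, t, ?_, h.orthogonal, h.isBlock, h4⟩
    rw [DirectSum.isInternal_submodule_iff_iSupIndep_and_iSup_eq_top]
    exact ⟨h.iSupIndep, h.iSup_eq_top⟩

theorem IsMetricJordanForm.unique {m m' : Multiset (ℂ × ℕ × ℤˣ)} (h : IsMetricJordanForm B T m)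
    (h' : IsMetricJordanForm B T m') : m = m' := by
  classical
  have key : ∀ m m', IsMetricJordanForm B T m → IsMetricJordanForm B T m' → m ≤ m' := by
    intro m m' h h'
    obtain ⟨k, W, t, hW, rfl⟩ := isMetricJordanForm_iff.1 h
    obtain ⟨k', W', t', hW', rfl⟩ := isMetricJordanForm_iff.1 h'
    rw [Multiset.le_iff_count]
    intro t₀
    by_cases h₀ : t₀ ∈ Finset.univ.val.map t
    · have hadm : IsAdmissible t₀ := by
        obtain ⟨i, -, rfl⟩ := Multiset.mem_map.1 h₀
        exact (hW.isBlock i).isAdmissible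
      have := hW.card_le hW' hadm
      rw [Fintype.card_subtype, Fintype.card_subtype] at this
      rw [Multiset.count_map, Multiset.count_map]
      simpa [eq_comm, Finset.card_def, Finset.filter_val] using this
    · rw [Multiset.count_eq_zero_of_notMem h₀]
      exact Nat.zero_le _
  exact le_antisymm (key _ _ h h') (key _ _ h' h)

end

/-! ### Cyclic vectors with antidiagonal Gram matrix -/

section

theorem exists_eq_re_mul {K : Type*} [RCLike K] (f : K →ₗ[ℝ] ℝ) :
    ∃ h : K, ∀ c, f c = RCLike.re (h * c) := by
  -- The formula covers both fields: for `K = ℝ` one has `RCLike.I = 0` and the second term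
  -- disappears.
  refine ⟨(f 1 : K) - (f RCLike.I : K) * RCLike.I, fun c => ?_⟩
  have hc : c = RCLike.re c • (1 : K) + RCLike.im c • (RCLike.I : K) := by
    rw [RCLike.real_smul_eq_coe_mul, RCLike.real_smul_eq_coe_mul, mul_one, RCLike.re_add_im]
  have h1 : f c = RCLike.re c * f 1 + RCLike.im c * f RCLike.I := by
    conv_lhs => rw [hc]
    simp
  rw [h1, sub_mul, map_sub, RCLike.re_ofReal_mul, mul_assoc, RCLike.re_ofReal_mul, RCLike.I_mul_re]
  ring

variable {V : Type*} [AddCommGroup V] [Module ℝ V] {B : LinearMap.BilinForm ℝ V}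

theorem exists_form_pow_ne_zero (hsymm : ∀ x y, B x y = B y x)
    (hnd : ∀ x, (∀ y, B x y = 0) → x = 0) {A : Module.End ℝ V}
    (hA : ∀ x y, B (A x) y = B x (A y)) (h0 : A ≠ 0) : ∃ x, B (A x) x ≠ 0 := by
  by_contra! h
  refine h0 (LinearMap.ext fun x => hnd _ fun y => ?_)
  have h1 := h (x + y)
  simp only [map_add, LinearMap.add_apply, h, zero_add, add_zero] at h1
  rw [hA y x, hsymm y (A x)] at h1
  linarith

theorem pow_selfAdjoint {N : Module.End ℝ V} (hN : ∀ x y, B (N x) y = B x (N y)) (n : ℕ) (x y : V) :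
    B ((N ^ n) x) y = B x ((N ^ n) y) := by
  induction n generalizing x y with
  | zero => simp
  | succ n ih => rw [pow_succ, Module.End.mul_apply, ih, hN, ← Module.End.mul_apply, ← pow_succ',
      ← pow_succ]

theorem aeval_selfAdjoint {N : Module.End ℝ V} (hN : ∀ x y, B (N x) y = B x (N y)) (g : ℝ[X])
    (x y : V) : B (aeval N g x) y = B x (aeval N g y) := by
  induction g using Polynomial.induction_on' with
  | add g g' hg hg' => simp only [map_add, LinearMap.add_apply, hg, hg']
  | monomial n a =>
    simp only [aeval_monomial, Module.algebraMap_end_eq_smul_id, Module.End.mul_apply,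
      LinearMap.smul_apply, LinearMap.id_apply, map_smul, pow_selfAdjoint hN]

/-- A nilpotent self-adjoint operator `N` over a field `K` acting by self-adjoint operators has a
cyclic vector of maximal height whose `K`-valued Gram matrix is antidiagonal. -/
theorem exists_adapted_vector {K : Type*} [RCLike K] [Nontrivial V]
    (hsymm : ∀ x y, B x y = B y x) (hnd : ∀ x, (∀ y, B x y = 0) → x = 0)
    (φ : K →ₐ[ℝ] Module.End ℝ V) (hφ : ∀ c x y, B (φ c x) y = B x (φ c y))
    {N : Module.End ℝ V} (hN : ∀ x y, B (N x) y = B x (N y)) (hnil : IsNilpotent N)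
    (hcomm : ∀ c, Commute N (φ c)) {P : ℤˣ → Prop}
    (hP : ∀ h : K, h ≠ 0 → ∃ ε : ℤˣ, P ε ∧ ∃ d : K, h * d ^ 2 = ((ε : ℤ) : K)) :
    ∃ (p : ℕ) (ε : ℤˣ) (x : V), 0 < p ∧ P ε ∧ N ^ p = 0 ∧ ∀ n c,
      B (φ c ((N ^ n) x)) x = if n + 1 = p then RCLike.re (((ε : ℤ) : K) * c) else 0 := by
  obtain ⟨p, hp0, hpm⟩ : ∃ p, N ^ p = 0 ∧ ∀ m, m < p → N ^ m ≠ 0 := by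
    classical
    exact ⟨Nat.find hnil, Nat.find_spec hnil, fun m hm => Nat.find_min hnil hm⟩
  have hp : 0 < p := by
    rcases Nat.eq_zero_or_pos p with rfl | h
    · simp at hp0
    · exact h
  have hpow : ∀ n, p ≤ n → N ^ n = 0 := fun n hn => pow_eq_zero_of_le hn hp0
  have hswap : ∀ n c x, (N ^ n) (φ c x) = φ c ((N ^ n) x) := fun n c x =>
    LinearMap.congr_fun ((hcomm c).pow_left n).eq x
  have hmul : ∀ c d x, φ c (φ d x) = φ (c * d) x := fun c d x => by rw [map_mul]; rfl
  have hNmul : ∀ m n x, (N ^ m) ((N ^ n) x) = (N ^ (m + n)) x := fun m n x => by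
    rw [pow_add]; rfl
  obtain ⟨x, hx⟩ := exists_form_pow_ne_zero hsymm hnd (pow_selfAdjoint hN (p - 1))
    (hpm _ (by omega))
  obtain ⟨h, hh⟩ := exists_eq_re_mul
    (((B.flip x) ∘ₗ LinearMap.applyₗ ((N ^ (p - 1)) x)) ∘ₗ φ.toLinearMap)
  replace hh : ∀ c, B (φ c ((N ^ (p - 1)) x)) x = RCLike.re (h * c) := hh
  have hne : h ≠ 0 := by
    rintro rfl
    apply hx
    simpa using hh 1
  obtain ⟨ε, hε, d, hd⟩ := hP h hne
  -- Replacing `x` by a unit `u` of `K[N]` applied to `x` multiplies the series of its products by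
  -- `u ^ 2`. The vector `φ d x` normalizes the top product to `ε`; the other products are then
  -- killed one at a time, as in extracting the square root of a power series.
  have key : ∀ m, m ≤ p - 1 → ∃ x, ∀ c, B (φ c ((N ^ (p - 1)) x)) x =
      RCLike.re (((ε : ℤ) : K) * c) ∧
      ∀ j, 0 < j → j ≤ m → B (φ c ((N ^ (p - 1 - j)) x)) x = 0 := by
    intro m
    induction m with
    | zero =>
      intro _
      refine ⟨φ d x, fun c => ⟨?_, fun j hj hj' => by omega⟩⟩
      rw [hswap, hmul, ← hφ, hmul, hh, ← hd]
      congr 1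
      ring
    | succ m ih =>
      intro hm
      obtain ⟨x, hx⟩ := ih (by omega)
      obtain ⟨h, hh⟩ := exists_eq_re_mul
        (((B.flip x) ∘ₗ LinearMap.applyₗ ((N ^ (p - 1 - (m + 1))) x)) ∘ₗ φ.toLinearMap)
      replace hh : ∀ c, B (φ c ((N ^ (p - 1 - (m + 1))) x)) x = RCLike.re (h * c) := hh
      -- This solves `h + 2 * ε * c₀ = 0`, using `ε ^ 2 = 1`. The correction involves `N ^ (m + 1)`,
      -- so products normalized earlier change only by terms with exponent at least `p`, which
      -- vanish.
      set c₀ : K := -(((ε : ℤ) : K) * h / 2) with hc₀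
      have hexp : ∀ k c, B (φ c ((N ^ k) (x + φ c₀ ((N ^ (m + 1)) x))))
          (x + φ c₀ ((N ^ (m + 1)) x)) = B (φ c ((N ^ k) x)) x +
            2 * B (φ (c₀ * c) ((N ^ (k + (m + 1))) x)) x +
            B (φ (c₀ * c * c₀) ((N ^ (k + (m + 1) + (m + 1))) x)) x := by
        intro k c
        have e1 : B (φ c ((N ^ k) x)) (φ c₀ ((N ^ (m + 1)) x)) =
            B (φ (c₀ * c) ((N ^ (k + (m + 1))) x)) x := by
          rw [← hφ, hmul, ← pow_selfAdjoint hN, hswap, hNmul, add_comm k]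
        have e2 : ∀ z, B (φ c ((N ^ k) (φ c₀ ((N ^ (m + 1)) x)))) z =
            B (φ (c₀ * c) ((N ^ (k + (m + 1))) x)) z := by
          intro z
          rw [hswap, hmul, hNmul, mul_comm c]
        have e3 : B (φ (c₀ * c) ((N ^ (k + (m + 1))) x)) (φ c₀ ((N ^ (m + 1)) x)) =
            B (φ (c₀ * c * c₀) ((N ^ (k + (m + 1) + (m + 1))) x)) x := by
          rw [← hφ, hmul, ← pow_selfAdjoint hN, hswap, hNmul, add_comm (m + 1), mul_comm c₀]
        simp only [map_add, LinearMap.add_apply, e1, e2, e3]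
        ring
      have hzero : ∀ n, p ≤ n → ∀ c, B (φ c ((N ^ n) x)) x = 0 := by
        intro n hn c
        rw [hpow n hn]
        simp
      refine ⟨x + φ c₀ ((N ^ (m + 1)) x), fun c => ⟨?_, fun j hj hj' => ?_⟩⟩
      · rw [hexp, hzero (_ + _ + _) (by omega), hzero (_ + _) (by omega), (hx c).1]
        ring
      · rw [hexp, hzero (_ + _ + _) (by omega)]
        rcases Nat.lt_or_ge j (m + 1) with hlt | hge
        · rw [hzero (_ + _) (by omega), (hx c).2 j hj (by omega)]
          ring
        · obtain rfl : j = m + 1 := by omega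
          rw [hh, Nat.sub_add_cancel hm, (hx _).1, hc₀]
          have h2 : ((ε : ℤ) : K) * (-(((ε : ℤ) : K) * h / 2) * c) =
              ((-1 / 2 : ℝ) : K) * (h * c) := by
            rcases Int.units_eq_one_or ε with rfl | rfl <;> push_cast <;> simp <;> ring
          rw [h2, RCLike.re_ofReal_mul]
          ring
  obtain ⟨x, hx⟩ := key (p - 1) le_rfl
  refine ⟨p, ε, x, hp, hε, hp0, fun n c => ?_⟩
  split_ifs with hn
  · rw [show n = p - 1 by omega]
    exact (hx c).1
  · by_cases hnp : p ≤ n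
    · rw [hpow n hnp]
      simp
    · have := (hx c).2 (p - 1 - n) (by omega) (by omega)
      rwa [show p - 1 - (p - 1 - n) = n by omega] at this

/-- The block is the span of the `φ c (N ^ n x)`. Self-adjointness moves every operator to one side,
so all products are determined by those with `x` itself. -/
theorem exists_isCyclicModel {K : Type*} [RCLike K] [Nontrivial V]
    (hsymm : ∀ x y, B x y = B y x) (hnd : ∀ x, (∀ y, B x y = 0) → x = 0)
    (φ : K →ₐ[ℝ] Module.End ℝ V) (hφ : ∀ c x y, B (φ c x) y = B x (φ c y))
    {N : Module.End ℝ V} (hN : ∀ x y, B (N x) y = B x (N y)) (hnil : IsNilpotent N)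
    (hcomm : ∀ c, Commute N (φ c)) {P : ℤˣ → Prop}
    (hP : ∀ h : K, h ≠ 0 → ∃ ε : ℤˣ, P ε ∧ ∃ d : K, h * d ^ 2 = ((ε : ℤ) : K)) (l : K) :
    ∃ (p : ℕ) (ε : ℤˣ) (W : Submodule ℝ V) (E : ℕ → K →ₗ[ℝ] V), P ε ∧
      IsCyclicModel B (φ l + N) W l p ε E := by
  obtain ⟨p, ε, x, hp, hε, hp0, hx⟩ := exists_adapted_vector hsymm hnd φ hφ hN hnil hcomm hP
  let E : ℕ → K →ₗ[ℝ] V := fun n => LinearMap.applyₗ ((N ^ n) x) ∘ₗ φ.toLinearMap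
  have hE : ∀ n c, E n c = φ c ((N ^ n) x) := fun n c => rfl
  refine ⟨p, ε, _, E, hε, hp, ?_, ?_, ?_, rfl⟩
  · intro n hn
    ext c
    rw [hE, pow_eq_zero_of_le hn hp0]
    simp
  · intro n c
    rw [hE, hE, hE, LinearMap.add_apply, map_mul, Module.End.mul_apply, pow_succ',
      Module.End.mul_apply]
    congr 1
    exact LinearMap.congr_fun (hcomm c).eq _
  · intro m n c d
    have hswap : (N ^ n) (φ d (φ c ((N ^ m) x))) = φ (c * d) ((N ^ (m + n)) x) := by
      rw [← Module.End.mul_apply (φ d), ← map_mul, ← Module.End.mul_apply,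
        ((hcomm (d * c)).pow_left n).eq, Module.End.mul_apply, ← Module.End.mul_apply (N ^ n),
        ← pow_add, add_comm n, mul_comm d]
    rw [hE, hE, ← hφ, ← pow_selfAdjoint hN, hswap, hx]

theorem exists_isBlock_of_aeval_eq_zero [Nontrivial V]
    (hsymm : ∀ x y, B x y = B y x) (hnd : ∀ x, (∀ y, B x y = 0) → x = 0)
    {N S : Module.End ℝ V} (hN : ∀ x y, B (N x) y = B x (N y)) (hnil : IsNilpotent N)
    (hS : ∀ x y, B (S x) y = B x (S y)) (hcomm : Commute N S) {z : ℂ} (hz : 0 ≤ z.im)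
    (hzS : aeval S (realMinpoly z) = 0) : ∃ W t, IsBlock B (N + S) W t := by
  rcases hz.eq_or_lt with hz | hz
  · have hS' : S = algebraMap ℝ _ z.re := by
      rw [realMinpoly, if_pos hz.symm] at hzS
      simpa [sub_eq_zero] using hzS
    obtain ⟨p, ε, W, E, -, hE⟩ := exists_isCyclicModel (K := ℝ) hsymm hnd
      (Algebra.ofId ℝ (Module.End ℝ V))
      (fun c x y => by simp [Algebra.ofId_apply, Module.algebraMap_end_eq_smul_id]) hN hnil
      (fun c => (Algebra.commutes c N).symm) (P := fun _ => True) (fun h hh => by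
        rcases lt_or_gt_of_ne hh with h1 | h1
        · refine ⟨-1, trivial, (√(-h))⁻¹, ?_⟩
          rw [inv_pow, Real.sq_sqrt (by linarith)]
          field_simp
          simp
        · refine ⟨1, trivial, (√h)⁻¹, ?_⟩
          rw [inv_pow, Real.sq_sqrt (by linarith)]
          field_simp
          simp) z.re
    refine ⟨W, (z, p, ε), hE.pos, Or.inl ⟨hz.symm, ?_⟩⟩
    have := hE.hasMatrices_real
    rwa [Algebra.ofId_apply, ← hS', add_comm] at this
  · rw [realMinpoly, if_neg hz.ne'] at hzS
    -- The relation `(S - a) ^ 2 = -b ^ 2` makes this a self-adjoint complex structure commuting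
    -- with `N`, and `S` becomes multiplication by `z`.
    let J : Module.End ℝ V := z.im⁻¹ • (S - algebraMap ℝ _ z.re)
    have hJ : J * J = -1 := by
      have h1 : (S - algebraMap ℝ (Module.End ℝ V) z.re) * (S - algebraMap ℝ _ z.re) =
          -(algebraMap ℝ _ (z.im ^ 2)) := by
        rw [eq_neg_iff_add_eq_zero, ← pow_two]
        simpa using hzS
      simp only [J]
      rw [smul_mul_smul_comm, h1, Algebra.algebraMap_eq_smul_one, ← smul_neg, smul_smul]
      have : z.im⁻¹ * z.im⁻¹ * z.im ^ 2 = 1 := by field_simp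
      rw [this, one_smul]
    let φ : ℂ →ₐ[ℝ] Module.End ℝ V := Complex.lift ⟨J, hJ⟩
    have hφ : ∀ c, φ c = algebraMap ℝ _ c.re + c.im • J := fun c => Complex.liftAux_apply J hJ c
    have hφz : φ z = S := by
      rw [hφ]
      simp only [J]
      rw [smul_smul, mul_inv_cancel₀ hz.ne', one_smul, add_sub_cancel]
    have hJs : ∀ x y, B (J x) y = B x (J y) := by
      intro x y
      simp [J, hS, Module.algebraMap_end_eq_smul_id]
    have hJc : Commute N J := (hcomm.sub_right (Algebra.commutes _ _).symm).smul_right _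
    obtain ⟨p, ε, W, E, rfl, hE⟩ := exists_isCyclicModel (K := ℂ) hsymm hnd φ
      (fun c x y => by simp [hφ, hJs, Module.algebraMap_end_eq_smul_id]) hN hnil
      (fun c => by
        rw [hφ]
        exact (show Commute N _ from (Algebra.commutes _ _).symm).add_right (hJc.smul_right _))
      (P := fun ε => ε = 1) (fun h hh => by
        obtain ⟨d, hd⟩ := IsAlgClosed.exists_pow_nat_eq h⁻¹ (n := 2) (by norm_num)
        refine ⟨1, rfl, d, ?_⟩
        rw [hd, mul_inv_cancel₀ hh]
        simp) z
    refine ⟨W, (z, p, 1), hE.pos, Or.inr ⟨hz, rfl, ?_⟩⟩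
    have := hE.hasMatrices_complex
    rwa [hφz, add_comm] at this

end

/-! ### Splitting off blocks and existence of the form -/

section

variable {V : Type*} [AddCommGroup V] [Module ℝ V] {B : LinearMap.BilinForm ℝ V}

theorem HasMatrices.map {V' : Type*} [AddCommGroup V'] [Module ℝ V']
    {B' : LinearMap.BilinForm ℝ V'} {T : V →ₗ[ℝ] V} {T' : V' →ₗ[ℝ] V'} (f : V →ₗ[ℝ] V')
    (hf : Function.Injective f) (hB : ∀ x y, B' (f x) (f y) = B x y)
    (hT : ∀ x, T' (f x) = f (T x)) {W : Submodule ℝ V} {ι : Type} [Fintype ι] {G A : Matrix ι ι ℝ}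
    (h : HasMatrices B T W G A) : HasMatrices B' T' (W.map f) G A := by
  obtain ⟨e, h1, h2⟩ := h
  refine ⟨e.map (W.equivMapOfInjective f hf), fun i j => ?_, fun j => ?_⟩
  · simp [hB, h1]
  · simp [hT, h2]

theorem IsBlock.map {V' : Type*} [AddCommGroup V'] [Module ℝ V']
    {B' : LinearMap.BilinForm ℝ V'} {T : V →ₗ[ℝ] V} {T' : V' →ₗ[ℝ] V'} (f : V →ₗ[ℝ] V')
    (hf : Function.Injective f) (hB : ∀ x y, B' (f x) (f y) = B x y)
    (hT : ∀ x, T' (f x) = f (T x)) {W : Submodule ℝ V} {t : ℂ × ℕ × ℤˣ}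
    (h : IsBlock B T W t) : IsBlock B' T' (W.map f) t :=
  ⟨h.1, h.2.imp (fun h => ⟨h.1, h.2.map f hf hB hT⟩) fun h => ⟨h.1, h.2.1, h.2.2.map f hf hB hT⟩⟩

theorem IsBlock.ne_bot {T : V →ₗ[ℝ] V} {W : Submodule ℝ V} {t : ℂ × ℕ × ℤˣ}
    (h : IsBlock B T W t) : W ≠ ⊥ := by
  rintro rfl
  obtain ⟨⟨y, hy, -, hy'⟩, -⟩ := h.exists_form_pos
  rw [(Submodule.mem_bot ℝ).1 hy] at hy'
  simp at hy'

theorem realMinpoly_conj (z : ℂ) : realMinpoly (star z) = realMinpoly z := by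
  simp [realMinpoly]

theorem exists_dvd_realMinpoly {q : ℝ[X]} (hq : Irreducible q) :
    ∃ z : ℂ, 0 ≤ z.im ∧ q ∣ realMinpoly z := by
  obtain ⟨z, hz⟩ := IsAlgClosed.exists_aeval_eq_zero ℂ q (degree_pos_of_irreducible hq).ne'
  have h1 : q ∣ realMinpoly z := by
    have h2 := minpoly.eq_of_irreducible hq hz
    have h3 : minpoly ℝ z ∣ realMinpoly z := by
      apply minpoly.dvd
      rw [realMinpoly]
      split_ifs with h
      · simp [Complex.ext_iff, h]
      · simp [Complex.ext_iff, pow_two]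
    rw [← h2] at h3
    exact (dvd_mul_right _ _).trans h3
  rcases le_total 0 z.im with h | h
  · exact ⟨z, h, h1⟩
  · exact ⟨star z, by simpa using h, by rwa [realMinpoly_conj]⟩

theorem subtype_aeval_restrict {A : Module.End ℝ V} {U : Submodule ℝ V} (h : ∀ x ∈ U, A x ∈ U)
    (g : ℝ[X]) (x : U) : (aeval (A.restrict h) g x : V) = aeval A g (x : V) := by
  induction g using Polynomial.induction_on' with
  | add g g' hg hg' => simp only [map_add, LinearMap.add_apply, Submodule.coe_add, hg, hg']
  | monomial n a =>
    have h1 : (((A.restrict h) ^ n) x : V) = (A ^ n) x := by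
      induction n with
      | zero => simp
      | succ n ih => rw [pow_succ', pow_succ', Module.End.mul_apply, Module.End.mul_apply,
          LinearMap.coe_restrict_apply, ih]
    simp only [aeval_monomial, Module.algebraMap_end_eq_smul_id, Module.End.mul_apply,
      LinearMap.smul_apply, LinearMap.id_apply, Submodule.coe_smul, h1]

theorem exists_isBlock [FiniteDimensional ℝ V] [Nontrivial V]
    (hsymm : ∀ x y, B x y = B y x) (hnd : ∀ x, (∀ y, B x y = 0) → x = 0)
    {T : Module.End ℝ V} (hT : ∀ x y, B (T x) y = B x (T y)) : ∃ W t, IsBlock B T W t := by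
  obtain ⟨N, hN, S, hS, hnil, hss, hTNS⟩ := Module.End.exists_isNilpotent_isSemisimple (f := T)
  rw [Algebra.adjoin_singleton_eq_range_aeval] at hN hS
  obtain ⟨gN, rfl⟩ := hN
  obtain ⟨gS, rfl⟩ := hS
  set N : Module.End ℝ V := aeval T gN with hNdef
  set S : Module.End ℝ V := aeval T gS with hSdef
  replace hnil : IsNilpotent N := hnil
  replace hss : S.IsSemisimple := hss
  replace hTNS : T = N + S := hTNS
  have hNs := aeval_selfAdjoint hT gN
  have hSs := aeval_selfAdjoint hT gS
  have hcomm : Commute N S := (Commute.all gN gS).map (aeval T)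
  obtain ⟨q, hq, r, hqr⟩ := WfDvdMonoid.exists_irreducible_factor (minpoly.not_isUnit ℝ S)
    (minpoly.ne_zero (Algebra.IsIntegral.isIntegral S))
  -- Semisimplicity enters here: the minimal polynomial of `S` is squarefree, so `q` does not divide
  -- its cofactor.
  have hcop : IsCoprime q r := by
    rw [hq.coprime_iff_not_dvd]
    intro h
    exact hq.not_isUnit (hss.minpoly_squarefree q (hqr ▸ mul_dvd_mul_left q h))
  have hqr0 : ∀ x, aeval S q (aeval S r x) = 0 := fun x => by
    rw [← Module.End.mul_apply, ← map_mul, ← hqr, minpoly.aeval]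
    rfl
  let U : Submodule ℝ V := LinearMap.ker (aeval S q)
  have hU : ∀ g : Module.End ℝ V, Commute g S → ∀ x ∈ U, g x ∈ U := by
    intro g hg x hx
    have h1 : Commute g (aeval S q) := by
      have : aeval S q ∈ Subalgebra.centralizer ℝ {g} := by
        refine (Algebra.adjoin_le (S := Subalgebra.centralizer ℝ {g}) ?_)
          (aeval_mem_adjoin_singleton ℝ S (p := q))
        rintro _ rfl
        rw [SetLike.mem_coe, Subalgebra.mem_centralizer_iff]
        rintro _ rfl
        exact hg.eq
      rw [Subalgebra.mem_centralizer_iff] at this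
      exact this g rfl
    rw [LinearMap.mem_ker] at hx ⊢
    rw [← Module.End.mul_apply, ← h1.eq, Module.End.mul_apply, hx, map_zero]
  have hUN := hU N hcomm
  have hUS := hU S (Commute.refl S)
  have hUne : U ≠ ⊥ := by
    intro hbot
    have hr : aeval S r = 0 := by
      ext x
      have : aeval S r x ∈ U := hqr0 x
      rw [hbot] at this
      exact this
    have h1 : q * r ∣ 1 * r := by
      rw [← hqr, one_mul]
      exact minpoly.dvd ℝ S hr
    have hr0 : r ≠ 0 := by
      rintro rfl
      exact minpoly.ne_zero (Algebra.IsIntegral.isIntegral S) (by rw [hqr, mul_zero])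
    exact hq.not_isUnit (isUnit_of_dvd_one ((mul_dvd_mul_iff_right hr0).1 h1))
  have : Nontrivial U := Submodule.nontrivial_iff_ne_bot.2 hUne
  have hUnd : ∀ x : U, (∀ y : U, (B.restrict U) x y = 0) → x = 0 := by
    intro x hx
    obtain ⟨a, b, hab⟩ := hcop
    have : (x : V) = 0 := by
      refine hnd _ fun v => ?_
      -- The Bézout identity splits `v`: the first summand is orthogonal to `ker q(S)` by
      -- self-adjointness and the second lies in it, so `U` inherits non-degeneracy.
      have hv : v = aeval S q (aeval S a v) + aeval S r (aeval S b v) := by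
        have := LinearMap.congr_fun (congrArg (aeval S) hab) v
        rw [map_add, mul_comm a, mul_comm b, map_mul, map_mul, map_one] at this
        exact this.symm
      rw [hv, map_add, ← aeval_selfAdjoint hSs, LinearMap.mem_ker.1 x.2]
      simpa using hx ⟨aeval S r (aeval S b v), hqr0 _⟩
    exact Subtype.ext this
  obtain ⟨z, hz, hdvd⟩ := exists_dvd_realMinpoly hq
  obtain ⟨W, t, hW⟩ := exists_isBlock_of_aeval_eq_zero (B := B.restrict U)
    (N := N.restrict hUN) (S := S.restrict hUS)
    (fun x y => hsymm _ _) hUnd (fun x y => hNs _ _)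
    (by
      obtain ⟨n, hn⟩ := hnil
      refine ⟨n, ?_⟩
      ext x
      have := subtype_aeval_restrict hUN (X ^ n) x
      simpa [hn] using this)
    (fun x y => hSs _ _)
    (by
      ext x
      exact LinearMap.congr_fun hcomm.eq (x : V)) hz
    (by
      obtain ⟨g, hg⟩ := hdvd
      ext x
      rw [subtype_aeval_restrict, hg, mul_comm, map_mul, Module.End.mul_apply,
        LinearMap.mem_ker.1 x.2]
      simp)
  refine ⟨_, t, hW.map U.subtype U.injective_subtype (fun x y => rfl) fun x => ?_⟩
  rw [hTNS]
  rfl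

theorem exists_block_family [FiniteDimensional ℝ V] (hsymm : ∀ x y, B x y = B y x)
    {T : Module.End ℝ V} (hT : ∀ x y, B (T x) y = B x (T y)) (U : Submodule ℝ V)
    (hU : ∀ x ∈ U, T x ∈ U) (hnd : ∀ x ∈ U, (∀ y ∈ U, B x y = 0) → x = 0) :
    ∃ (k : ℕ) (W : Fin k → Submodule ℝ V) (t : Fin k → ℂ × ℕ × ℤˣ),
      (∀ i j, i ≠ j → ∀ x ∈ W i, ∀ y ∈ W j, B x y = 0) ∧ (∀ i, IsBlock B T (W i) (t i)) ∧
      ⨆ i, W i = U := by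
  induction hn : Module.finrank ℝ U using Nat.strong_induction_on generalizing U with
  | _ n ih =>
    subst hn
    by_cases hbot : U = ⊥
    · subst hbot
      exact ⟨0, Fin.elim0, Fin.elim0, fun i => i.elim0, fun i => i.elim0, by simp⟩
    have : Nontrivial U := Submodule.nontrivial_iff_ne_bot.2 hbot
    obtain ⟨W', t₀, hW'⟩ := exists_isBlock (B := B.restrict U) (T := T.restrict hU)
      (fun x y => hsymm _ _)
      (fun x hx => Subtype.ext (hnd _ x.2 fun y hy => hx ⟨y, hy⟩)) (fun x y => hT _ _)
    have hW₀ := hW'.map (B' := B) (T' := T) U.subtype U.injective_subtype (fun _ _ => rfl)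
      fun _ => rfl
    set W₀ := W'.map U.subtype
    have hW₀U : W₀ ≤ U := Submodule.map_subtype_le U W'
    have hcompl : IsCompl W₀ (B.orthogonal W₀) := by
      rw [LinearMap.BilinForm.isCompl_orthogonal_iff_disjoint
        (fun x y h => by rw [hsymm, h])]
      rw [Submodule.disjoint_def]
      intro x hx hx'
      refine hW₀.eq_zero_of_orthogonal hx fun y hy => ?_
      rw [hsymm]
      exact hx' y hy
    let U' := U ⊓ B.orthogonal W₀
    have hsup : W₀ ⊔ U' = U := by
      rw [show U' = B.orthogonal W₀ ⊓ U from inf_comm _ _, ← sup_inf_assoc_of_le _ hW₀U, hcompl.sup_eq_top, top_inf_eq]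
    have horth : ∀ x ∈ W₀, ∀ y ∈ U', B x y = 0 := fun x hx y hy => hy.2 x hx
    have hlt : U' < U := by
      -- Equality would put `W₀` inside its own orthogonal complement, which meets it trivially,
      -- although a block is nonzero.
      refine lt_of_le_of_ne inf_le_left fun h => hW₀.ne_bot ?_
      rw [eq_bot_iff, ← hcompl.inf_eq_bot]
      refine le_inf le_rfl (hW₀U.trans ?_)
      rw [← h]
      exact inf_le_right
    obtain ⟨k, W, t, h1, h2, h3⟩ := ih _ (Submodule.finrank_lt_finrank_of_lt hlt) U'
      (fun x hx => ⟨hU _ hx.1, fun y hy => by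
        have := hx.2 _ (hW₀.map_mem hy)
        exact (hT y x).symm.trans this⟩)
      (fun x hx hx' => hnd x hx.1 fun y hy => by
        rw [← hsup] at hy
        obtain ⟨w, hw, u, hu, rfl⟩ := Submodule.mem_sup.1 hy
        rw [map_add, hx' u hu, hsymm, horth w hw x hx, zero_add]) rfl
    have hWU : ∀ i, W i ≤ U' := fun i => h3 ▸ le_iSup W i
    refine ⟨k + 1, Fin.cons W₀ W, Fin.cons t₀ t, ?_, ?_, ?_⟩
    · intro i j
      refine Fin.cases ?_ (fun i => ?_) i <;> refine Fin.cases ?_ (fun j => ?_) j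
      · simp
      · intro _ x hx y hy
        exact horth x hx y (hWU j hy)
      · intro _ x hx y hy
        rw [hsymm]
        exact horth y hy x (hWU i hx)
      · intro hij x hx y hy
        exact h1 i j (fun h => hij (by rw [h])) x hx y hy
    · intro i
      refine Fin.cases ?_ (fun i => ?_) i
      · exact hW₀
      · exact h2 i
    · rw [← hsup, ← h3]
      apply le_antisymm
      · refine iSup_le fun i => ?_
        refine Fin.cases ?_ (fun i => ?_) i
        · exact le_sup_left
        · exact (le_iSup W i).trans le_sup_right
      · refine sup_le ?_ (iSup_le fun i => ?_)
        · exact le_iSup (Fin.cons W₀ W : Fin (k + 1) → Submodule ℝ V) 0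
        · exact le_iSup (Fin.cons W₀ W : Fin (k + 1) → Submodule ℝ V) i.succ

theorem exists_isMetricJordanForm [FiniteDimensional ℝ V] (hsymm : ∀ x y, B x y = B y x)
    (hnd : ∀ x, (∀ y, B x y = 0) → x = 0)
    {T : Module.End ℝ V} (hT : ∀ x y, B (T x) y = B x (T y)) : ∃ m, IsMetricJordanForm B T m := by
  obtain ⟨k, W, t, h1, h2, h3⟩ := exists_block_family hsymm hT ⊤ (fun _ _ => trivial)
    (fun x _ hx => hnd x fun y => hx y trivial)
  exact ⟨_, isMetricJordanForm_iff.2 ⟨k, W, t, ⟨h1, h2, h3⟩, rfl⟩⟩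

/-! ### Transport by isometries and their construction from equal forms -/

theorem IsMetricJordanForm.map {S T : V →ₗ[ℝ] V} {m : Multiset (ℂ × ℕ × ℤˣ)}
    (h : IsMetricJordanForm B S m) (R : V ≃ₗ[ℝ] V) (hR : ∀ x y, B (R x) (R y) = B x y)
    (hT : ∀ x, T (R x) = R (S x)) : IsMetricJordanForm B T m := by
  obtain ⟨k, W, t, hW, rfl⟩ := isMetricJordanForm_iff.1 h
  refine isMetricJordanForm_iff.2
    ⟨k, fun i => (W i).map R.toLinearMap, t, ⟨?_, fun i => ?_, ?_⟩, rfl⟩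
  · rintro i j hij _ ⟨x, hx, rfl⟩ _ ⟨y, hy, rfl⟩
    exact (hR x y).trans (hW.orthogonal i j hij x hx y hy)
  · exact (hW.isBlock i).map R.toLinearMap R.injective hR hT
  · rw [← Submodule.map_iSup, hW.iSup_eq_top, Submodule.map_top, LinearEquiv.range]

/-- The map takes one adapted basis to the other: equal `G` makes it preserve products, and equal
`A` makes it intertwine the operators. -/
theorem HasMatrices.exists_isometry {S T : V →ₗ[ℝ] V} {W W' : Submodule ℝ V} {ι : Type} [Fintype ι]
    {G A : Matrix ι ι ℝ} (h : HasMatrices B S W G A) (h' : HasMatrices B T W' G A) :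
    ∃ r : W →ₗ[ℝ] V, (∀ x, r x ∈ W') ∧ (∀ x y, B (r x) (r y) = B x y) ∧
      ∀ x hx, T (r x) = r ⟨S x, hx⟩ := by
  obtain ⟨e, he, hS⟩ := h
  obtain ⟨e', he', hT⟩ := h'
  let r : W →ₗ[ℝ] V := e.constr ℝ fun j => (e' j : V)
  have hr : ∀ j, r (e j) = e' j := fun j => e.constr_basis ℝ (fun j => (e' j : V)) j
  have hSW : ∀ j, ∃ w : W, (w : V) = S (e j) ∧ r w = T (e' j) := fun j =>
    ⟨∑ i, A i j • e i, by simp [hS], by simp [hr, hT]⟩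
  refine ⟨r, fun x => ?_, fun x y => ?_, fun x hx => ?_⟩
  · rw [e.constr_apply_fintype ℝ (fun j => (e' j : V)) x]
    exact W'.sum_mem fun i _ => W'.smul_mem _ (e' i).2
  · have : B.compl₁₂ r r = B.compl₁₂ W.subtype W.subtype := by
      refine LinearMap.ext_basis e e fun i j => ?_
      simp [hr, he, he']
    exact LinearMap.congr_fun₂ this x y
  · obtain ⟨c, rfl⟩ : ∃ c : ι → ℝ, ∑ j, c j • e j = x := ⟨_, e.sum_repr x⟩
    choose w hw hw' using hSW
    have h1 : (⟨S (∑ j, c j • e j : W), hx⟩ : W) = ∑ j, c j • w j := Subtype.ext (by simp [hw])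
    rw [h1]
    simp [hr, hw']

theorem IsBlock.exists_isometry {S T : V →ₗ[ℝ] V} {W W' : Submodule ℝ V} {t : ℂ × ℕ × ℤˣ}
    (h : IsBlock B S W t) (h' : IsBlock B T W' t) :
    ∃ r : W →ₗ[ℝ] V, (∀ x, r x ∈ W') ∧ (∀ x y, B (r x) (r y) = B x y) ∧
      ∀ x hx, T (r x) = r ⟨S x, hx⟩ := by
  obtain ⟨-, ⟨h1, h2⟩ | ⟨h1, -, h2⟩⟩ := h <;> obtain ⟨-, ⟨h1', h2'⟩ | ⟨h1', -, h2'⟩⟩ := h'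
  · exact h2.exists_isometry h2'
  · exact absurd h1 h1'.ne'
  · exact absurd h1' h1.ne'
  · exact h2.exists_isometry h2'

theorem IsBlockDecomposition.exists_isometry [FiniteDimensional ℝ V]
    (hnd : ∀ x, (∀ y, B x y = 0) → x = 0) {ι : Type*} [Fintype ι] {S T : V →ₗ[ℝ] V}
    {W W' : ι → Submodule ℝ V} {t : ι → ℂ × ℕ × ℤˣ} (h : IsBlockDecomposition B S W t)
    (h' : IsBlockDecomposition B T W' t) :
    ∃ R : V ≃ₗ[ℝ] V, (∀ x y, B (R x) (R y) = B x y) ∧ ∀ x, T (R x) = R (S x) := by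
  classical
  choose r hr hrB hrT using fun i => (h.isBlock i).exists_isometry (h'.isBlock i)
  have hint : Function.Bijective (DirectSum.coeLinearMap W) :=
    (DirectSum.isInternal_submodule_iff_iSupIndep_and_iSup_eq_top W).2 ⟨h.iSupIndep, h.iSup_eq_top⟩
  let R : V →ₗ[ℝ] V := DirectSum.toModule ℝ ι V r ∘ₗ
    (LinearEquiv.ofBijective (DirectSum.coeLinearMap W) hint).symm.toLinearMap
  have hR : ∀ i (x : W i), R x = r i x := by
    intro i x
    have h1 : (LinearEquiv.ofBijective (DirectSum.coeLinearMap W) hint).symm (x : V) =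
        DirectSum.lof ℝ ι (fun i => W i) i x := by
      rw [LinearEquiv.symm_apply_eq, LinearEquiv.ofBijective_apply, DirectSum.coeLinearMap_lof]
    simp only [R, LinearMap.comp_apply, LinearEquiv.coe_coe, h1, DirectSum.toModule_lof]
  have hRB : ∀ x y, B (R x) (R y) = B x y := by
    intro x y
    obtain ⟨f, hf, rfl⟩ := h.exists_eq_sum x
    obtain ⟨g, hg, rfl⟩ := h.exists_eq_sum y
    have hRf : ∀ i, R (f i) ∈ W' i := fun i => by rw [hR i ⟨f i, hf i⟩]; exact hr i _
    have hRg : ∀ i, R (g i) ∈ W' i := fun i => by rw [hR i ⟨g i, hg i⟩]; exact hr i _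
    rw [map_sum R g, map_sum (B _), map_sum (B _), map_sum R f]
    refine Finset.sum_congr rfl fun i _ => ?_
    rw [h'.form_sum_left hRf (hRg i), h.form_sum_left hf (hg i), hR i ⟨f i, hf i⟩,
      hR i ⟨g i, hg i⟩, hrB]
  -- Preserving a non-degenerate form implies injectivity; finite dimension then gives bijectivity.
  have hinj : Function.Injective R := by
    rw [← LinearMap.ker_eq_bot, LinearMap.ker_eq_bot']
    intro x hx
    refine hnd x fun y => ?_
    rw [← hRB, hx]
    simp
  refine ⟨LinearEquiv.ofInjectiveEndo R hinj, hRB, fun x => ?_⟩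
  simp only [LinearEquiv.coe_ofInjectiveEndo]
  obtain ⟨f, hf, rfl⟩ := h.exists_eq_sum x
  simp only [map_sum]
  refine Finset.sum_congr rfl fun i _ => ?_
  have hSf : S (f i) ∈ W i := (h.isBlock i).map_mem (hf i)
  rw [hR i ⟨f i, hf i⟩, hrT i _ hSf]
  exact (hR i ⟨S (f i), hSf⟩).symm

/-- Equal multiplicities mean that corresponding fibres have the same cardinality; bijections of the
fibres glue to one of the index sets. -/
theorem exists_equiv_of_map_univ_eq {ι κ α : Type*} [Fintype ι] [Fintype κ] {f : ι → α} {g : κ → α}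
    (h : Finset.univ.val.map f = Finset.univ.val.map g) : ∃ σ : ι ≃ κ, f = g ∘ σ := by
  classical
  have hcard : ∀ a, Nonempty ({i // f i = a} ≃ {j // g j = a}) := by
    intro a
    rw [← Fintype.card_eq, Fintype.card_subtype, Fintype.card_subtype]
    have h1 := congrArg (Multiset.count a) h
    rw [Multiset.count_map, Multiset.count_map] at h1
    simpa [eq_comm, Finset.card_def, Finset.filter_val] using h1
  refine ⟨(Equiv.sigmaFiberEquiv f).symm.trans
    ((Equiv.sigmaCongrRight fun a => (hcard a).some).trans (Equiv.sigmaFiberEquiv g)), funext fun i => ?_⟩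
  exact ((hcard (f i)).some ⟨i, rfl⟩).2.symm

theorem IsMetricJordanForm.exists_isometry [FiniteDimensional ℝ V]
    (hnd : ∀ x, (∀ y, B x y = 0) → x = 0) {S T : V →ₗ[ℝ] V} {m : Multiset (ℂ × ℕ × ℤˣ)}
    (hS : IsMetricJordanForm B S m) (hT : IsMetricJordanForm B T m) :
    ∃ R : V ≃ₗ[ℝ] V, (∀ x y, B (R x) (R y) = B x y) ∧ ∀ x, T (R x) = R (S x) := by
  obtain ⟨k, W, t, h, rfl⟩ := isMetricJordanForm_iff.1 hS
  obtain ⟨k', W', t', h', heq⟩ := isMetricJordanForm_iff.1 hT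
  obtain ⟨σ, rfl⟩ := exists_equiv_of_map_univ_eq heq
  refine h.exists_isometry hnd (W' := W' ∘ σ) ⟨?_, fun i => h'.isBlock (σ i), ?_⟩
  · exact fun i j hij => h'.orthogonal _ _ (σ.injective.ne hij)
  · exact (σ.iSup_comp (g := W')).trans h'.iSup_eq_top

end

end MetricJordan

theorem mainTheorem3 {V : Type*} [AddCommGroup V] [Module ℝ V] [FiniteDimensional ℝ V]
    (B : LinearMap.BilinForm ℝ V) (hsymm : B.IsSymm) (hnondeg : B.Nondegenerate)
    (S T : V →ₗ[ℝ] V) (hS : B.IsSelfAdjoint S) (hT : B.IsSelfAdjoint T) :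
    (∃! m, MetricJordan.IsMetricJordanForm B S m) ∧
    (∃! m, MetricJordan.IsMetricJordanForm B T m) ∧
    ∀ mS mT, MetricJordan.IsMetricJordanForm B S mS → MetricJordan.IsMetricJordanForm B T mT →
      ((∃ R : V ≃ₗ[ℝ] V, (∀ x y, B (R x) (R y) = B x y) ∧
          T = R.toLinearMap ∘ₗ S ∘ₗ R.symm.toLinearMap) ↔ mS = mT) := by
  have key : ∀ A : V →ₗ[ℝ] V, B.IsSelfAdjoint A →
      ∃! m, MetricJordan.IsMetricJordanForm B A m := by
    intro A hA
    obtain ⟨m, hm⟩ := MetricJordan.exists_isMetricJordanForm hsymm.eq hnondeg.1 hA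
    exact ⟨m, hm, fun m' hm' => hm'.unique hm⟩
  refine ⟨key S hS, key T hT, fun mS mT hmS hmT => ⟨?_, ?_⟩⟩
  · rintro ⟨R, hR, rfl⟩
    exact (hmS.map R hR (by simp)).unique hmT
  · rintro rfl
    obtain ⟨R, hR, hRT⟩ := hmS.exists_isometry hnondeg.1 hmT
    refine ⟨R, hR, LinearMap.ext fun x => ?_⟩
    simpa using hRT (R.symm x)
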